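/- Let $d\ge 2$ and $\alpha=\frac d2-1$. For each $k\ge 0$ let $(Y_k^h)_{h\in\mathcal H_k}$ be a (finite) orthonormal basis, for the surface measure on $S^{d-1}$, of the space of complex hyperspherical harmonics of degree $k$ (restrictions to $S^{d-1}$ of complex harmonic polynomials on $\mathbb R^d$ that are homogeneous of degree $k$), and for $\mathbf x\neq 0$ write $Y_k^h(\mathbf x)=Y_k^h(\mathbf x/|\mathbf x|)$ (for $\mathbf x = 0$ put $Y_k^h(0)=0$ if $k\ge1$, and let $Y_0^h(0)$ be the constant value of $Y_0^h$). Let $K$ be a complex-valued function that is real-analytic on $(0,\infty)$, and let $\mathbf r,\mathbf r'\in\mathbb R^d$ with $r=|\mathbf r|>0$ and $r'=|\mathbf r'|$. Assume that $r',r$ lie within the radius of convergence $R\in(0,\infty]$ of the Taylor series of $\varepsilon\mapsto K(r\sqrt{1+\varepsilon})$ at $\varepsilon=0$, in the sense that $\left|\frac{r'}r\left(\frac{r'}r-2\cos\gamma\right)\right|<R$ for every angle $\gamma$; if $\mathbf r'=\mathbf r$, assume also that $K$ is continuous from the right at $0$. Then \[ K(|\mathbf r'-\mathbf r|)=\sum_{k=0}^\infty\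 \sum_{h\in\mathcal H_k} Y_k^h(\mathbf r)\,Y_k^h(\mathbf r')^*\,\mathcal K^{(k)}(r',r), \qquad \mathcal K^{(k)}(r',r)=\sum_{j=k}^\infty r'^j\sum_{m=0}^j K^{(m)}(r)\,r^{m-j}\,\mathcal T^{(\alpha)}_{jkm}, \] where the series over $k$ and, for every $k$, the series over $j$ converge absolutely. The constants depend only on the dimension; they are \[ \mathcal T^{(\alpha)}_{jkm}=\sum_{n=\max(\lceil (j+k)/2\rceil,\,m)}^{j} a_{k,2n-j}\,(-2)^{2n-j}\binom{n}{2n-j}\frac{1}{n!}\,\mathcal B_{nm}, \] where \[ a_{k,i}=\frac{2\pi^{d/2}}{\Gamma(d/2)}\cdot\frac{i!}{2^i\,\left(\frac{i-k}2\right)!\,(d/2)_{(i+k)/2}}\quad\text{if } k\le i,\ k\equiv i \bmod 2,\qquad a_{k,i}=0\ \text{otherwise}, \] $(a)_n=a(a+1)\cdots(a+n-1)$, and \[ \mathcal B_{nm}=(-1)^{n+m}\frac{(2n-2m-1)!!}{2^n}\binom{2n-m-1}{m-1}\quad(n\ge m\ge 1),\qquad \mathcal B_{00}=1,\quad \mathcal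 B_{n0}=0\ (n\ge 1), \] with $(-1)!!=1$. In particular $\mathcal T^{(\alpha)}_{jk0}=0$ unless $j=k=0$. -/

import Mathlib

open scoped Nat

noncomputable section

namespace FKT

/-- Euclidean space `ℝᵈ`. -/
abbrev E (d : ℕ) : Type := EuclideanSpace ℝ (Fin d)

/-- Complex polynomials in `d` variables, homogeneous of degree `k` and annihilated by the
Laplacian `∑ᵢ ∂ᵢ²`. -/
def solidHarmonics (d k : ℕ) : Submodule ℂ (MvPolynomial (Fin d) ℂ) where
  carrier := {p | p.IsHomogeneous k ∧
    ∑ i, MvPolynomial.pderiv i (MvPolynomial.pderiv i p) = 0}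
  add_mem' := by
    rintro p q ⟨hp, hp'⟩ ⟨hq, hq'⟩
    refine ⟨hp.add hq, ?_⟩
    simp [Finset.sum_add_distrib, hp', hq']
  zero_mem' := ⟨MvPolynomial.isHomogeneous_zero _ _ _, by simp⟩
  smul_mem' := by
    rintro c p ⟨hp, hp'⟩
    refine ⟨(MvPolynomial.homogeneousSubmodule (Fin d) ℂ k).smul_mem c hp, ?_⟩
    simp [← Finset.smul_sum, hp']

/-- The angular part `x ↦ p (x / |x|)` of a polynomial. (At `x = 0`, where there is no direction,
this is `p 0`; so the angular part of a constant is that constant on all of `ℝᵈ`.) -/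
def angularPart (d : ℕ) : MvPolynomial (Fin d) ℂ →ₗ[ℂ] (E d → ℂ) where
  toFun p x := MvPolynomial.eval (fun i => (((‖x‖⁻¹ • x) i : ℝ) : ℂ)) p
  map_add' p q := by ext x; simp
  map_smul' c p := by ext x; simp

/-- The space of hyperspherical harmonics of degree `k` on `ℝᵈ`, as functions of the direction
`x / |x|` of the vector `x`. -/
def hypersphericalHarmonics (d k : ℕ) : Submodule ℂ (E d → ℂ) :=
  (solidHarmonics d k).map (angularPart d)

/-- `Y` is an orthonormal basis of the space of hyperspherical harmonics of degree `k`, for the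
surface measure on the unit sphere. -/
structure IsHarmonicBasis (d k : ℕ) {ι : Type*} (Y : ι → E d → ℂ) : Prop where
  span_eq : Submodule.span ℂ (Set.range Y) = hypersphericalHarmonics d k
  norm_one : ∀ h, ∫ ω : Metric.sphere (0 : E d) 1,
    Y h ω * starRingEnd ℂ (Y h ω) ∂(MeasureTheory.volume : MeasureTheory.Measure (E d)).toSphere = 1
  orthogonal : ∀ h h', h ≠ h' → ∫ ω : Metric.sphere (0 : E d) 1,
    Y h ω * starRingEnd ℂ (Y h' ω) ∂(MeasureTheory.volume : MeasureTheory.Measure (E d)).toSphere = 0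

/-- `ε = (r'/r) (r'/r - 2 cos γ)`, so that `|x' - x| = r √(1 + ε)` when `|x| = r`, `|x'| = r'` and
the angle between `x` and `x'` is `γ`. -/
def eps (r' r γ : ℝ) : ℝ := r' / r * (r' / r - 2 * Real.cos γ)

/-- The radius of convergence of the Taylor series at `ε = 0` of `ε ↦ K (r √(1 + ε))`. -/
def taylorRadius (K : ℝ → ℂ) (r : ℝ) : ENNReal :=
  (FormalMultilinearSeries.ofScalars ℂ (fun n : ℕ =>
    iteratedDeriv n (fun ε : ℝ => K (r * √(1 + ε))) 0 / (n ! : ℂ))).radius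

/-- The area `2 π^(d/2) / Γ(d/2)` of the unit sphere of `ℝᵈ`. -/
def sphereArea (d : ℕ) : ℝ := 2 * Real.pi ^ ((d : ℝ) / 2) / Real.Gamma ((d : ℝ) / 2)

/-- The coefficient of `∑ₕ Yₖʰ(x) Yₖʰ(y)*` in the expansion of `(x ⬝ y) ^ i` over the unit sphere.
With `α = d/2 - 1 > 0` it is `Zₖ * Aₖᵢ`, where
`Aₖᵢ = i! (α + k) / (2ⁱ ((i-k)/2)! (α)₍₍ᵢ₊ₖ₎/₂₊₁₎)` (for `k ≤ i`, `k ≡ i mod 2`) are the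
coefficients of `tⁱ` over the Gegenbauer polynomials `Cₖ^α(t)`, and
`Zₖ = sphereArea d * α / (α + k)` is the constant of the addition theorem. After cancellation of
`α (α + k)` the product makes sense for `d = 2`, `α = 0` as well. -/
def ZA (d k i : ℕ) : ℝ :=
  if k ≤ i ∧ Even (i - k) then
    sphereArea d * (i ! : ℝ) /
      (2 ^ i * (((i - k) / 2) ! : ℝ) * (ascPochhammer ℝ ((i + k) / 2)).eval ((d : ℝ) / 2))
  else 0

/-- The numbers `Bₙₘ` with `(d/dε)ⁿ K (r √(1 + ε)) = ∑ₘ Bₙₘ K⁽ᵐ⁾(r) rᵐ` at `ε = 0`, with the usual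
conventions `B₀₀ = 1` and `Bₙ₀ = 0` for `n > 0`. (Here `(-1)‼ = 1`.) -/
def B (n m : ℕ) : ℝ :=
  if m = 0 then (if n = 0 then 1 else 0)
  else if n < m then 0
  else (-1) ^ (n + m) * ((2 * n - 2 * m - 1)‼ : ℝ) / 2 ^ n * ((2 * n - m - 1).choose (m - 1) : ℝ)

/-- The constants `T_{jkm}` in dimension `d`. -/
def T (d j k m : ℕ) : ℝ :=
  ∑ n ∈ Finset.Icc (max ((j + k + 1) / 2) m) j,
    ZA d k (2 * n - j) * (-2) ^ (2 * n - j) * (n.choose (2 * n - j) : ℝ) / (n ! : ℝ) * B n m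

/-- The `j`-th term `r'^j ∑ₘ K⁽ᵐ⁾(r) r^(m-j) T_{jkm}` of the radial factor. The summand `m = 0`
vanishes unless `j = k = 0`. -/
def radialTerm (d : ℕ) (K : ℝ → ℂ) (k : ℕ) (r' r : ℝ) (j : ℕ) : ℂ :=
  (r' : ℂ) ^ j * ∑ m ∈ Finset.Icc 0 j,
    iteratedDeriv m K r * (r : ℂ) ^ ((m : ℤ) - (j : ℤ)) * (T d j k m : ℂ)

/-- The radial factor `𝒦⁽ᵏ⁾(r', r) = ∑_{j ≥ k} r'^j ∑ₘ K⁽ᵐ⁾(r) r^(m-j) T_{jkm}`. -/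
def radialFactor (d : ℕ) (K : ℝ → ℂ) (k : ℕ) (r' r : ℝ) : ℂ :=
  ∑' i : ℕ, radialTerm d K k r' r (k + i)

end FKT

end

/-!
Integrating by parts against a Gaussian weight, and passing to polar coordinates, gives the
Funk–Hecke formula `∫ (x ⬝ ω)ⁱ p(ω) dω = ZA d k i * p(x)` for a solid harmonic `p` of degree `k`.
As every polynomial of degree `i` agrees on the sphere with a sum of solid harmonics,
`(x ⬝ y)ⁱ = ∑ₖ ZA d k i * ∑ₕ Yₖʰ(x) Yₖʰ(y)*` for unit vectors `x`, `y`. This replaces the addition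
theorem for Gegenbauer polynomials and includes `d = 2`.

With `s = r' / r` and `t = cos γ`, expand `K (r √(1 + ε))` in powers of `ε = s² - 2 s t`, expand
each `εⁿ` binomially, and replace each `tⁱ` by its harmonic expansion. Convergence at `γ = π`, the
largest value of `ε`, makes the binomial series absolutely convergent. On the diagonal the harmonic
expansion of `tⁱ` has nonnegative terms with sum `1`, so off the diagonal the sum of the absolute
values is at most `1`; hence the sum over `k` can be moved outside, and what multiplies the kernel
of degree `k`, sorted by powers of `r'`, is the radial factor. Its numbers `B n m` are pinned
down by the recurrence that one more differentiation of `K (r √(1 + ε))` imposes on them.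
-/

noncomputable section

namespace FKT

section Polynomials

open MvPolynomial

variable {σ R : Type*} [CommRing R]

/-- The derivative `∑ᵢ wᵢ ∂ᵢ` of polynomials in the direction `w`. -/
def dirDeriv (w : σ → R) : Derivation R (MvPolynomial σ R) (MvPolynomial σ R) :=
  mkDerivation R fun i => C (w i)

lemma dirDeriv_X (w : σ → R) (i : σ) : dirDeriv w (X i) = C (w i) :=
  mkDerivation_X R _ i

lemma dirDeriv_single [DecidableEq σ] (i : σ) : dirDeriv (Pi.single i (1 : R)) = pderiv i := by
  refine derivation_ext fun j => ?_
  rw [dirDeriv_X, pderiv_X, Pi.single_apply, Pi.single_apply]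
  split_ifs <;> simp

lemma dirDeriv_comm (v w : σ → R) (p : MvPolynomial σ R) :
    dirDeriv v (dirDeriv w p) = dirDeriv w (dirDeriv v p) := by
  have key : ⁅dirDeriv v, dirDeriv w⁆ = 0 := derivation_ext fun i => by
    rw [Derivation.commutator_apply, dirDeriv_X, dirDeriv_X, derivation_C, derivation_C, sub_zero,
      Derivation.zero_apply]
  rw [← sub_eq_zero, ← Derivation.commutator_apply, key, Derivation.zero_apply]

lemma eq_C_of_isHomogeneous_zero {f : MvPolynomial σ R} (hf : f.IsHomogeneous 0) :
    f = C (coeff 0 f) :=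
  totalDegree_eq_zero_iff_eq_C.1 ((totalDegree_zero_iff_isHomogeneous _).2 hf)

variable [Fintype σ]

/-- The linear form `∑ᵢ wᵢ Xᵢ`. -/
def linForm (w : σ → R) : MvPolynomial σ R := ∑ i, C (w i) * X i

/-- The Laplacian `∑ᵢ ∂ᵢ²` on polynomials. -/
def laplacian (σ R : Type*) [Fintype σ] [CommRing R] : MvPolynomial σ R →ₗ[R] MvPolynomial σ R :=
  ∑ i, (pderiv i).toLinearMap ∘ₗ (pderiv i).toLinearMap

/-- The polynomial `∑ᵢ Xᵢ²`, the square of the Euclidean norm. -/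
def normSq (σ R : Type*) [Fintype σ] [CommRing R] : MvPolynomial σ R := ∑ i, X i ^ 2

/-- The harmonic polynomials that are homogeneous of degree `k`: the solid harmonics,
in an arbitrary finite set of variables and over an arbitrary ring. -/
def harmonicSubmodule (σ R : Type*) [Fintype σ] [CommRing R] (k : ℕ) :
    Submodule R (MvPolynomial σ R) :=
  homogeneousSubmodule σ R k ⊓ LinearMap.ker (laplacian σ R)

lemma laplacian_apply (p : MvPolynomial σ R) :
    laplacian σ R p = ∑ i, pderiv i (pderiv i p) := by
  simp [laplacian]

lemma mem_harmonicSubmodule {k : ℕ} {p : MvPolynomial σ R} :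
    p ∈ harmonicSubmodule σ R k ↔ p.IsHomogeneous k ∧ laplacian σ R p = 0 :=
  Iff.rfl

lemma solidHarmonics_eq (d k : ℕ) : solidHarmonics d k = harmonicSubmodule (Fin d) ℂ k := by
  ext p
  rw [mem_harmonicSubmodule, laplacian_apply]
  rfl

lemma isHomogeneous_linForm (w : σ → R) : (linForm w).IsHomogeneous 1 :=
  IsHomogeneous.sum _ _ _ fun i _ => isHomogeneous_C_mul_X _ i

lemma linForm_single [DecidableEq σ] (i : σ) : linForm (Pi.single i (1 : R)) = X i := by
  rw [linForm, Finset.sum_eq_single_of_mem i (Finset.mem_univ i)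
    fun j _ hj => by rw [Pi.single_eq_of_ne hj, map_zero, zero_mul]]
  rw [Pi.single_eq_same, map_one, one_mul]

lemma dirDeriv_linForm (v w : σ → R) : dirDeriv v (linForm w) = C (∑ i, v i * w i) := by
  simp only [linForm, map_sum, Derivation.leibniz, dirDeriv_X, derivation_C, smul_eq_mul,
    mul_zero, zero_add, map_mul, mul_comm (C (w _))]

lemma dirDeriv_eq_sum (w : σ → R) (p : MvPolynomial σ R) :
    dirDeriv w p = ∑ i, C (w i) * pderiv i p := by
  classical
  induction p using MvPolynomial.induction_on with
  | C c => simp only [derivation_C, mul_zero, Finset.sum_const_zero]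
  | add p q hp hq => simp only [map_add, hp, hq, mul_add, Finset.sum_add_distrib]
  | mul_X p j hp =>
    have key : ∑ i, p * (C (w i) * pderiv i (X j)) = p * C (w j) := by
      rw [Finset.sum_eq_single_of_mem j (Finset.mem_univ j)
        fun i _ hi => by rw [pderiv_X_of_ne hi.symm, mul_zero, mul_zero]]
      rw [pderiv_X_self, mul_one]
    simp only [Derivation.leibniz, dirDeriv_X, smul_eq_mul, mul_add, Finset.sum_add_distrib, key,
      hp, Finset.mul_sum, mul_left_comm]

lemma laplacian_dirDeriv (w : σ → R) (p : MvPolynomial σ R) :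
    laplacian σ R (dirDeriv w p) = dirDeriv w (laplacian σ R p) := by
  classical
  simp only [laplacian_apply, map_sum, ← dirDeriv_single, dirDeriv_comm _ w]

lemma dirDeriv_mem_harmonicSubmodule (w : σ → R) {k : ℕ} {p : MvPolynomial σ R}
    (hp : p ∈ harmonicSubmodule σ R k) : dirDeriv w p ∈ harmonicSubmodule σ R (k - 1) := by
  obtain ⟨hom, harm⟩ := mem_harmonicSubmodule.1 hp
  refine mem_harmonicSubmodule.2 ⟨?_, by rw [laplacian_dirDeriv, harm, map_zero]⟩
  rw [dirDeriv_eq_sum]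
  refine IsHomogeneous.sum _ _ _ fun i _ => ?_
  simpa only [zero_add] using (isHomogeneous_C σ (w i)).mul (hom.pderiv (i := i))

lemma isHomogeneous_laplacian {n : ℕ} {f : MvPolynomial σ R} (hf : f.IsHomogeneous n) :
    (laplacian σ R f).IsHomogeneous (n - 2) := by
  rw [laplacian_apply]
  exact IsHomogeneous.sum _ _ _ fun i _ => hf.pderiv.pderiv

lemma laplacian_eq_zero {n : ℕ} (hn : n < 2) {f : MvPolynomial σ R} (hf : f.IsHomogeneous n) :
    laplacian σ R f = 0 := by
  rw [laplacian_apply]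
  refine Finset.sum_eq_zero fun i _ => ?_
  have const : (pderiv i f).IsHomogeneous 0 :=
    Nat.sub_eq_zero_of_le (Nat.le_of_lt_succ hn) ▸ hf.pderiv
  rw [eq_C_of_isHomogeneous_zero const, pderiv_C]

lemma isHomogeneous_normSq : (normSq σ R).IsHomogeneous 2 :=
  IsHomogeneous.sum _ _ _ fun i _ => isHomogeneous_X_pow i 2

lemma pderiv_normSq (i : σ) : pderiv i (normSq σ R) = 2 * X i := by
  classical
  rw [normSq, map_sum, Finset.sum_eq_single_of_mem i (Finset.mem_univ i)
    fun j _ hj => by rw [pderiv_pow, pderiv_X_of_ne hj, mul_zero]]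
  rw [pderiv_pow, pderiv_X_self, mul_one, pow_one, Nat.cast_ofNat]

lemma laplacian_normSq_mul {m : ℕ} {f : MvPolynomial σ R} (hf : f.IsHomogeneous m) :
    laplacian σ R (normSq σ R * f) =
      ((2 * Fintype.card σ + 4 * m : ℕ) : R) • f + normSq σ R * laplacian σ R f := by
  have key (i : σ) : pderiv i (pderiv i (normSq σ R * f)) =
      2 * f + 4 * (X i * pderiv i f) + normSq σ R * pderiv i (pderiv i f) := by
    have two : pderiv i (2 : MvPolynomial σ R) = 0 := by rw [← map_ofNat C 2, pderiv_C]
    simp only [pderiv_mul, map_add, pderiv_normSq, two, pderiv_X_self]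
    ring
  rw [laplacian_apply, laplacian_apply, Finset.sum_congr rfl fun i _ => key i,
    Finset.sum_add_distrib, Finset.sum_add_distrib, ← Finset.mul_sum, ← Finset.mul_sum,
    ← Finset.mul_sum, hf.sum_X_mul_pderiv]
  simp only [Finset.sum_const, Finset.card_univ, nsmul_eq_mul, smul_eq_C_mul, map_natCast]
  push_cast
  ring

lemma laplacian_normSq_pow_mul {m : ℕ} {f : MvPolynomial σ R}
    (hf : f ∈ harmonicSubmodule σ R m) (j : ℕ) :
    laplacian σ R (normSq σ R ^ (j + 1) * f) =
      ((2 * (j + 1) * (Fintype.card σ + 2 * m + 2 * j) : ℕ) : R) • (normSq σ R ^ j * f) := by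
  obtain ⟨hom, harm⟩ := mem_harmonicSubmodule.1 hf
  induction j with
  | zero =>
    rw [zero_add, pow_one, laplacian_normSq_mul hom, harm, mul_zero, add_zero, pow_zero, one_mul]
    congr 2
    ring
  | succ j ih =>
    rw [pow_succ', mul_assoc, laplacian_normSq_mul ((isHomogeneous_normSq.pow (j + 1)).mul hom), ih]
    simp only [smul_eq_C_mul, map_natCast]
    push_cast
    ring

/-- The span of the polynomials of degree `n` of the form `|x|^(2j) h` with `h` homogeneous and
harmonic; it turns out to contain all homogeneous polynomials of degree `n`. -/
def harmonicSpan (σ R : Type*) [Fintype σ] [CommRing R] (n : ℕ) : Submodule R (MvPolynomial σ R) :=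
  Submodule.span R
    {f | ∃ j m, 2 * j + m = n ∧ ∃ h ∈ harmonicSubmodule σ R m, f = normSq σ R ^ j * h}

lemma normSq_pow_mul_mem_harmonicSpan {m : ℕ} {h : MvPolynomial σ R}
    (hh : h ∈ harmonicSubmodule σ R m) (j : ℕ) :
    normSq σ R ^ j * h ∈ harmonicSpan σ R (2 * j + m) :=
  Submodule.subset_span ⟨j, m, rfl, h, hh, rfl⟩

lemma harmonicSpan_le_homogeneousSubmodule (n : ℕ) :
    harmonicSpan σ R n ≤ homogeneousSubmodule σ R n := by
  refine Submodule.span_le.2 ?_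
  rintro _ ⟨j, m, rfl, h, hh, rfl⟩
  exact (isHomogeneous_normSq.pow j).mul hh.1

lemma harmonicSpan_le_map_laplacian {F : Type*} [Field F] [CharZero F] [Nonempty σ] (n : ℕ) :
    harmonicSpan σ F n ≤ (harmonicSpan σ F (n + 2)).map (laplacian σ F) := by
  refine Submodule.span_le.2 ?_
  rintro _ ⟨j, m, rfl, h, hh, rfl⟩
  set c : F := ((2 * (j + 1) * (Fintype.card σ + 2 * m + 2 * j) : ℕ) : F) with c_def
  have hc : c ≠ 0 := by
    have := Fintype.card_pos (α := σ)
    rw [c_def, Nat.cast_ne_zero]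
    positivity
  refine ⟨c⁻¹ • (normSq σ F ^ (j + 1) * h), Submodule.smul_mem _ _ ?_, ?_⟩
  · rw [show 2 * j + m + 2 = 2 * (j + 1) + m by ring]
    exact normSq_pow_mul_mem_harmonicSpan hh (j + 1)
  · rw [map_smul, laplacian_normSq_pow_mul hh, inv_smul_smul₀ hc]

theorem homogeneousSubmodule_eq_harmonicSpan {F : Type*} [Field F] [CharZero F] [Nonempty σ]
    (n : ℕ) : homogeneousSubmodule σ F n = harmonicSpan σ F n := by
  refine le_antisymm ?_ (harmonicSpan_le_homogeneousSubmodule n)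
  induction n using Nat.strong_induction_on with
  | _ n ih =>
    intro f hf
    have mem_of_harmonic {g : MvPolynomial σ F} (hg : g.IsHomogeneous n)
        (harm : laplacian σ F g = 0) : g ∈ harmonicSpan σ F n := by
      simpa using normSq_pow_mul_mem_harmonicSpan (mem_harmonicSubmodule.2 ⟨hg, harm⟩) 0
    rcases lt_or_ge n 2 with hn | hn
    · exact mem_of_harmonic hf (laplacian_eq_zero hn hf)
    · obtain ⟨m, rfl⟩ := Nat.exists_eq_add_of_le' hn
      obtain ⟨u, hu, lap_u⟩ :=
        harmonicSpan_le_map_laplacian m (ih m (by omega) (isHomogeneous_laplacian hf))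
      have hom_u := harmonicSpan_le_homogeneousSubmodule _ hu
      rw [← sub_add_cancel f u]
      exact add_mem (mem_of_harmonic (hf.sub hom_u) (by rw [map_sub, lap_u, sub_self])) hu

end Polynomials

section Gaussian

open MvPolynomial MeasureTheory Asymptotics

variable {σ : Type*}

/-- The evaluation of complex polynomials at a real point. -/
def evalAt (x : EuclideanSpace ℝ σ) : MvPolynomial σ ℂ →ₐ[ℂ] ℂ := aeval fun i => (x i : ℂ)

/-- The direction `v`, as a vector of complex coefficients. -/
def complexify (v : EuclideanSpace ℝ σ) : σ → ℂ := fun i => (v i : ℂ)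

@[simp] lemma evalAt_X (x : EuclideanSpace ℝ σ) (i : σ) : evalAt x (X i) = (x i : ℂ) :=
  aeval_X _ i

@[simp] lemma evalAt_C (x : EuclideanSpace ℝ σ) (c : ℂ) : evalAt x (C c) = c :=
  aeval_C _ c

lemma evalAt_real_smul {m : ℕ} {p : MvPolynomial σ ℂ} (hp : p.IsHomogeneous m) (r : ℝ)
    (x : EuclideanSpace ℝ σ) : evalAt (r • x) p = (r : ℂ) ^ m * evalAt x p := by
  simp only [evalAt, aeval_def, eval₂_eq, Finset.mul_sum]
  refine Finset.sum_congr rfl fun n hn => ?_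
  have degree_n : ∑ i ∈ n.support, n i = m := (hp.degree_eq_sum_deg_support hn).symm
  simp only [PiLp.smul_apply, smul_eq_mul, Complex.ofReal_mul, mul_pow, Finset.prod_mul_distrib,
    Finset.prod_pow_eq_pow_sum, degree_n]
  ring

lemma continuous_evalAt (p : MvPolynomial σ ℂ) :
    Continuous fun x : EuclideanSpace ℝ σ => evalAt x p := by
  simp only [evalAt, aeval_def, eval₂_eq]
  fun_prop

lemma hasLineDerivAt_evalAt (p : MvPolynomial σ ℂ) (x v : EuclideanSpace ℝ σ) :
    HasLineDerivAt ℝ (fun x => evalAt x p) (evalAt x (dirDeriv (complexify v) p)) x v := by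
  unfold HasLineDerivAt
  induction p using MvPolynomial.induction_on with
  | C c => simpa using hasDerivAt_const (0 : ℝ) c
  | add p q hp hq => simpa using hp.fun_add hq
  | mul_X p j hp =>
    have coord : HasDerivAt (fun t : ℝ => (((x + t • v) j : ℝ) : ℂ)) (v j) 0 :=
      HasDerivAt.ofReal_comp <| by
        simpa using ((hasDerivAt_id (0 : ℝ)).mul_const (v j)).const_add (x j)
    simpa [dirDeriv_X, complexify, mul_comm, add_comm] using hp.fun_mul coord

lemma evalAt_dirDeriv_self [Finite σ] (y : EuclideanSpace ℝ σ) {k : ℕ} {p : MvPolynomial σ ℂ}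
    (hp : p.IsHomogeneous k) : evalAt y (dirDeriv (complexify y) p) = k * evalAt y p := by
  cases nonempty_fintype σ
  have euler := congrArg (evalAt y) hp.sum_X_mul_pderiv
  simpa only [dirDeriv_eq_sum, map_sum, map_mul, evalAt_C, complexify, evalAt_X, map_nsmul,
    nsmul_eq_mul, map_natCast] using euler

variable [Fintype σ]

/-- The Gaussian weight `exp (-|x|² / 2)`, normalised so that integration by parts exchanges
multiplication by `Xᵢ` with `∂ᵢ`. -/
def gaussian (x : EuclideanSpace ℝ σ) : ℝ := Real.exp (-(1 / 2) * ‖x‖ ^ 2)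

lemma evalAt_linForm (x y : EuclideanSpace ℝ σ) :
    evalAt x (linForm (complexify y)) = (inner ℝ x y : ℝ) := by
  simp [linForm, complexify, PiLp.inner_apply]

lemma evalAt_normSq (x : EuclideanSpace ℝ σ) : evalAt x (normSq σ ℂ) = (‖x‖ : ℂ) ^ 2 := by
  rw [normSq, map_sum, ← Complex.ofReal_pow, EuclideanSpace.real_norm_sq_eq]
  simp

lemma hasLineDerivAt_gaussian (x v : EuclideanSpace ℝ σ) :
    HasLineDerivAt ℝ gaussian (-(inner ℝ x v) * gaussian x) x v := by
  have h := (((hasStrictFDerivAt_norm_sq x).hasFDerivAt.const_mul (-(1 / 2))).exp).hasLineDerivAt v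
  refine h.congr_deriv ?_
  simp [gaussian, mul_comm]

lemma isBigO_evalAt (p : MvPolynomial σ ℂ) {a : ℝ} (ha : 0 < a) :
    (fun x => evalAt x p) =O[⊤] fun x : EuclideanSpace ℝ σ => Real.exp (a * ‖x‖ ^ 2) := by
  induction p using MvPolynomial.induction_on generalizing a with
  | C c =>
    refine isBigO_top.2 ⟨‖c‖, fun x => ?_⟩
    rw [evalAt_C, Real.norm_of_nonneg (Real.exp_pos _).le]
    exact le_mul_of_one_le_right (norm_nonneg _) (Real.one_le_exp (by positivity))
  | add p q hp hq => simpa only [map_add] using (hp ha).add (hq ha)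
  | mul_X p j hp =>
    have coord : (fun x => evalAt x (X j)) =O[⊤]
        fun x : EuclideanSpace ℝ σ => Real.exp (a / 2 * ‖x‖ ^ 2) := by
      refine isBigO_top.2 ⟨1 + 1 / (2 * a), fun x => ?_⟩
      rw [evalAt_X, Complex.norm_real, Real.norm_of_nonneg (Real.exp_pos _).le]
      have key : ‖x‖ ≤ (1 + 1 / (2 * a)) * (a / 2 * ‖x‖ ^ 2 + 1) := by
        have : (1 + 1 / (2 * a)) * (a / 2 * ‖x‖ ^ 2 + 1) - ‖x‖ =
            (‖x‖ / 2 - 1) ^ 2 + (a / 2 * ‖x‖ ^ 2 + 1 / (2 * a)) := by field_simp; ring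
        have : 0 ≤ a / 2 * ‖x‖ ^ 2 + 1 / (2 * a) := by positivity
        nlinarith [sq_nonneg (‖x‖ / 2 - 1)]
      calc ‖x j‖ ≤ ‖x‖ := PiLp.norm_apply_le x j
        _ ≤ (1 + 1 / (2 * a)) * (a / 2 * ‖x‖ ^ 2 + 1) := key
        _ ≤ _ := by gcongr; exact Real.add_one_le_exp _
    simpa only [map_mul, ← Real.exp_add, ← add_mul, add_halves] using (hp (half_pos ha)).mul coord

lemma integrable_gaussian_smul_evalAt (p : MvPolynomial σ ℂ) :
    Integrable fun x : EuclideanSpace ℝ σ => gaussian x • evalAt x p := by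
  have bound : (fun x : EuclideanSpace ℝ σ => gaussian x • evalAt x p) =O[⊤]
      fun x => Real.exp (-(1 / 4) * ‖x‖ ^ 2) := by
    have h := (isBigO_refl (gaussian (σ := σ)) ⊤).smul
      (isBigO_evalAt p (a := 1 / 4) (by norm_num))
    refine h.congr_right fun x => ?_
    rw [gaussian, smul_eq_mul, ← Real.exp_add]
    congr 1
    ring
  have integrable_exp : Integrable fun x : EuclideanSpace ℝ σ => Real.exp (-(1 / 4) * ‖x‖ ^ 2) := by
    have h := (GaussianFourier.integrable_cexp_neg_mul_sq_norm_add (V := EuclideanSpace ℝ σ)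
      (b := 1 / 4) (by norm_num) 0 0).norm
    refine h.congr (Filter.Eventually.of_forall fun x => ?_)
    simp only [zero_mul, add_zero]
    rw [← Complex.norm_of_nonneg (Real.exp_pos _).le]
    push_cast
    rfl
  have continuous_gaussian : Continuous (gaussian (σ := σ)) := by unfold gaussian; fun_prop
  exact bound.integrable (continuous_gaussian.smul (continuous_evalAt p)).aestronglyMeasurable
    integrable_exp

/-- The integral of a polynomial against the Gaussian weight. -/
def gaussInt (σ : Type*) [Fintype σ] : MvPolynomial σ ℂ →ₗ[ℂ] ℂ where
  toFun p := ∫ x : EuclideanSpace ℝ σ, gaussian x • evalAt x p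
  map_add' p q := by
    simp only [map_add, smul_add]
    exact integral_add (integrable_gaussian_smul_evalAt p) (integrable_gaussian_smul_evalAt q)
  map_smul' c p := by
    simp only [map_smul, smul_comm _ c, RingHom.id_apply]
    exact integral_smul c _

lemma gaussInt_apply (p : MvPolynomial σ ℂ) :
    gaussInt σ p = ∫ x : EuclideanSpace ℝ σ, gaussian x • evalAt x p := rfl

lemma gaussInt_linForm_mul (v : EuclideanSpace ℝ σ) (p : MvPolynomial σ ℂ) :
    gaussInt σ (linForm (complexify v) * p) = gaussInt σ (dirDeriv (complexify v) p) := by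
  have weight (x : EuclideanSpace ℝ σ) : (-(inner ℝ x v) * gaussian x) • evalAt x p =
      -(gaussian x • evalAt x (linForm (complexify v) * p)) := by
    simp only [map_mul, evalAt_linForm, Complex.real_smul]
    push_cast
    ring
  have by_parts := integral_bilinear_hasLineDerivAt_right_eq_neg_left_of_integrable (μ := volume)
    (B := ContinuousLinearMap.lsmul ℝ ℝ (E := ℂ)) (v := v) (f := gaussian)
    (f' := fun x => -(inner ℝ x v) * gaussian x) (g := fun x => evalAt x p)
    (g' := fun x => evalAt x (dirDeriv (complexify v) p))
    (((integrable_gaussian_smul_evalAt _).neg).congr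
      (Filter.Eventually.of_forall fun x => (weight x).symm))
    (integrable_gaussian_smul_evalAt _) (integrable_gaussian_smul_evalAt _)
    (fun x _ => hasLineDerivAt_gaussian x v) (fun x _ => hasLineDerivAt_evalAt p x v)
  simp only [ContinuousLinearMap.lsmul_apply, weight, integral_neg, neg_neg] at by_parts
  exact by_parts.symm

lemma gaussInt_X_mul (i : σ) (p : MvPolynomial σ ℂ) :
    gaussInt σ (X i * p) = gaussInt σ (pderiv i p) := by
  classical
  have h := gaussInt_linForm_mul (EuclideanSpace.single i 1) p
  have basis : complexify (EuclideanSpace.single i (1 : ℝ)) = Pi.single i 1 := by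
    ext j
    simp [complexify, Pi.single_apply, apply_ite]
  rwa [basis, linForm_single, dirDeriv_single] at h

/-- Green's first identity: Euler's formula and integration by parts. -/
lemma natCast_mul_gaussInt {m : ℕ} {q : MvPolynomial σ ℂ} (hq : q.IsHomogeneous m)
    (p : MvPolynomial σ ℂ) :
    (m : ℂ) * gaussInt σ (p * q) =
      gaussInt σ (∑ i, pderiv i p * pderiv i q) + gaussInt σ (p * laplacian σ ℂ q) := by
  have euler : (m : ℂ) • (p * q) = ∑ i, X i * (p * pderiv i q) := by
    rw [← mul_smul_comm, Nat.cast_smul_eq_nsmul, ← hq.sum_X_mul_pderiv, Finset.mul_sum]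
    exact Finset.sum_congr rfl fun i _ => mul_left_comm _ _ _
  rw [← smul_eq_mul, ← map_smul, euler, map_sum, laplacian_apply, Finset.mul_sum, ← map_add,
    ← Finset.sum_add_distrib, map_sum]
  refine Finset.sum_congr rfl fun i _ => ?_
  rw [gaussInt_X_mul, pderiv_mul]

lemma gaussInt_mul_eq_zero {k l : ℕ} (hkl : k ≠ l) {p q : MvPolynomial σ ℂ}
    (hp : p ∈ harmonicSubmodule σ ℂ k) (hq : q ∈ harmonicSubmodule σ ℂ l) :
    gaussInt σ (p * q) = 0 := by
  have green {m : ℕ} {p q : MvPolynomial σ ℂ} (hq : q ∈ harmonicSubmodule σ ℂ m) :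
      (m : ℂ) * gaussInt σ (p * q) = gaussInt σ (∑ i, pderiv i p * pderiv i q) := by
    rw [natCast_mul_gaussInt hq.1, (mem_harmonicSubmodule.1 hq).2, mul_zero, map_zero, add_zero]
  have symm : (k : ℂ) * gaussInt σ (p * q) = l * gaussInt σ (p * q) := by
    rw [green hq, mul_comm p, green hp]
    simp only [mul_comm]
  by_contra h
  exact hkl (Nat.cast_injective (mul_right_cancel₀ h symm))

lemma dirDeriv_linForm_pow_mul {y : EuclideanSpace ℝ σ} (hy : ‖y‖ = 1) (i : ℕ)
    (p : MvPolynomial σ ℂ) :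
    dirDeriv (complexify y) (linForm (complexify y) ^ i * p) =
      (i : ℂ) • (linForm (complexify y) ^ (i - 1) * p) +
        linForm (complexify y) ^ i * dirDeriv (complexify y) p := by
  have unit : ∑ i, complexify y i * complexify y i = 1 := by
    have := evalAt_normSq y
    rw [hy, Complex.ofReal_one, one_pow, normSq, map_sum] at this
    simpa only [sq, map_mul, evalAt_X, complexify] using this
  rw [Derivation.leibniz, Derivation.leibniz_pow, dirDeriv_linForm, unit, map_one]
  simp only [smul_eq_mul, nsmul_eq_mul, smul_eq_C_mul, map_natCast]
  ring

/-- The Gaussian moment of `(x ⬝ y)ⁱ` against a solid harmonic of degree `k` is this multiple of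
its value at the unit vector `y`. -/
def gaussCoeff (k i : ℕ) : ℚ :=
  if k ≤ i ∧ Even (i - k) then (i ! : ℚ) / (2 ^ ((i - k) / 2) * ((i - k) / 2)!) else 0

lemma gaussCoeff_zero_right (k : ℕ) : gaussCoeff k 0 = if k = 0 then 1 else 0 := by
  by_cases h : k = 0 <;> simp [gaussCoeff, h]

lemma gaussCoeff_add_two_mul (k a : ℕ) :
    gaussCoeff k (k + 2 * a) = (k + 2 * a)! / (2 ^ a * a !) := by
  simp [gaussCoeff]

lemma gaussCoeff_eq_zero {k i : ℕ} (h : ∀ a, i ≠ k + 2 * a) : gaussCoeff k i = 0 := by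
  rw [gaussCoeff, if_neg]
  rintro ⟨h1, a, ha⟩
  exact h a (by omega)

lemma natCast_mul_gaussCoeff_pred_left (k a i : ℕ) (h : i + 1 = k + 2 * a) :
    (k : ℚ) * gaussCoeff (k - 1) i = k * (i ! / (2 ^ a * a !)) := by
  rcases k with _ | k
  · simp only [Nat.cast_zero, zero_mul]
  · obtain rfl : i = k + 2 * a := by omega
    rw [Nat.add_sub_cancel, gaussCoeff_add_two_mul]

lemma natCast_mul_gaussCoeff_pred_right (k a i : ℕ) (h : i + 1 = k + 2 * a) :
    (i : ℚ) * gaussCoeff k (i - 1) = 2 * a * (i ! / (2 ^ a * a !)) := by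
  rcases a with _ | a
  · rcases i with _ | i
    · simp only [Nat.cast_zero, zero_mul, mul_zero]
    · rw [gaussCoeff_eq_zero fun a => by omega, Nat.cast_zero, mul_zero, mul_zero, zero_mul]
  · obtain rfl : i = k + 2 * a + 1 := by omega
    rw [Nat.add_sub_cancel, gaussCoeff_add_two_mul, Nat.factorial_succ (k + 2 * a),
      Nat.factorial_succ a]
    push_cast
    field_simp
    ring

lemma gaussCoeff_succ (k i : ℕ) :
    gaussCoeff k (i + 1) = i * gaussCoeff k (i - 1) + k * gaussCoeff (k - 1) i := by
  by_cases h : ∃ a, i + 1 = k + 2 * a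
  · obtain ⟨a, ha⟩ := h
    rw [natCast_mul_gaussCoeff_pred_left k a i ha, natCast_mul_gaussCoeff_pred_right k a i ha, ha,
      gaussCoeff_add_two_mul, ← ha, Nat.factorial_succ, ha]
    push_cast
    ring
  · push Not at h
    have left : (k : ℚ) * gaussCoeff (k - 1) i = 0 := by
      rcases k with _ | k
      · rw [Nat.cast_zero, zero_mul]
      · rw [gaussCoeff_eq_zero fun a => by have := h a; omega, mul_zero]
    have right : (i : ℚ) * gaussCoeff k (i - 1) = 0 := by
      rcases i with _ | i
      · rw [Nat.cast_zero, zero_mul]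
      · rw [gaussCoeff_eq_zero fun a => by have := h (a + 1); omega, mul_zero]
    rw [gaussCoeff_eq_zero h, left, right, add_zero]

lemma gaussInt_of_mem_harmonicSubmodule {k : ℕ} {p : MvPolynomial σ ℂ}
    (hp : p ∈ harmonicSubmodule σ ℂ k) (y : EuclideanSpace ℝ σ) :
    gaussInt σ p = if k = 0 then evalAt y p * gaussInt σ 1 else 0 := by
  split_ifs with hk
  · subst hk
    rw [eq_C_of_isHomogeneous_zero hp.1, evalAt_C, ← mul_one (C _), ← smul_eq_C_mul, map_smul,
      smul_eq_mul]
  · have one_mem : (1 : MvPolynomial σ ℂ) ∈ harmonicSubmodule σ ℂ 0 :=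
      ⟨isHomogeneous_one _ _, laplacian_eq_zero two_pos (isHomogeneous_one _ _)⟩
    simpa only [mul_one] using gaussInt_mul_eq_zero hk hp one_mem

lemma gaussInt_linForm_pow_mul {y : EuclideanSpace ℝ σ} (hy : ‖y‖ = 1) (i : ℕ) {k : ℕ}
    {p : MvPolynomial σ ℂ} (hp : p ∈ harmonicSubmodule σ ℂ k) :
    gaussInt σ (linForm (complexify y) ^ i * p) = gaussCoeff k i * evalAt y p * gaussInt σ 1 := by
  induction i using Nat.strong_induction_on generalizing k p with
  | _ i ih =>
    rcases i with _ | i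
    · rw [pow_zero, one_mul, gaussCoeff_zero_right, gaussInt_of_mem_harmonicSubmodule hp y]
      split_ifs <;> simp
    · rw [pow_succ', mul_assoc, gaussInt_linForm_mul, dirDeriv_linForm_pow_mul hy, map_add,
        map_smul, ih (i - 1) (by omega) hp,
        ih i (by omega) (dirDeriv_mem_harmonicSubmodule (complexify y) hp),
        evalAt_dirDeriv_self y hp.1, gaussCoeff_succ, smul_eq_mul]
      push_cast
      ring

end Gaussian

section Polar

open MeasureTheory MvPolynomial

lemma integral_volumeIoiPow {F : Type*} [NormedAddCommGroup F] [NormedSpace ℝ F] (n : ℕ)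
    (g : ℝ → F) :
    ∫ r : Set.Ioi (0 : ℝ), g r ∂(Measure.volumeIoiPow n) =
      ∫ r in Set.Ioi (0 : ℝ), r ^ n • g r := by
  simp only [Measure.volumeIoiPow, ENNReal.ofReal]
  rw [integral_withDensity_eq_integral_smul (measurable_subtype_coe.pow_const _).real_toNNReal,
    integral_subtype_comap measurableSet_Ioi fun a : ℝ => Real.toNNReal (a ^ n) • g a]
  refine setIntegral_congr_fun measurableSet_Ioi fun r hr => ?_
  rw [NNReal.smul_def, Real.coe_toNNReal _ (pow_nonneg (Set.mem_Ioi.1 hr).le _)]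

theorem integral_norm_smul_of_homogeneous {V F : Type*} [NormedAddCommGroup V] [NormedSpace ℝ V]
    [FiniteDimensional ℝ V] [Nontrivial V] [MeasurableSpace V] [BorelSpace V] (μ : Measure V)
    [μ.IsAddHaarMeasure] [NormedAddCommGroup F] [NormedSpace ℝ F] {f : V → F} {m : ℕ}
    (hf : ∀ (r : ℝ) (x : V), f (r • x) = r ^ m • f x) (g : ℝ → ℝ) :
    ∫ x, g ‖x‖ • f x ∂μ =
      (∫ r in Set.Ioi (0 : ℝ), r ^ (Module.finrank ℝ V - 1 + m) * g r) •
        ∫ ω : Metric.sphere (0 : V) 1, f ω ∂μ.toSphere := by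
  have polar (z : ({(0)}ᶜ : Set V)) : g ‖(z : V)‖ • f z =
      (fun y : Metric.sphere (0 : V) 1 × Set.Ioi (0 : ℝ) => ((y.2 : ℝ) ^ m * g y.2) • f y.1)
        (homeomorphUnitSphereProd V z) := by
    have hz : ‖(z : V)‖ ≠ 0 := norm_ne_zero_iff.2 z.2
    simp only [homeomorphUnitSphereProd_apply_fst_coe, homeomorphUnitSphereProd_apply_snd_coe,
      mul_comm _ (g _), mul_smul, ← hf, smul_inv_smul₀ hz]
  calc
    ∫ x, g ‖x‖ • f x ∂μ
        = ∫ z : ({(0)}ᶜ : Set V), g ‖(z : V)‖ • f z ∂(μ.comap Subtype.val) := by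
      rw [integral_subtype_comap (measurableSet_singleton _).compl fun z : V => g ‖z‖ • f z,
        restrict_compl_singleton]
    _ = ∫ y : Metric.sphere (0 : V) 1 × Set.Ioi (0 : ℝ), ((y.2 : ℝ) ^ m * g y.2) • f y.1
          ∂(μ.toSphere.prod (Measure.volumeIoiPow (Module.finrank ℝ V - 1))) := by
      rw [← μ.measurePreserving_homeomorphUnitSphereProd.integral_comp
        (Homeomorph.measurableEmbedding _)]
      exact integral_congr_ae (Filter.Eventually.of_forall polar)
    _ = (∫ r : Set.Ioi (0 : ℝ), (r : ℝ) ^ m * g r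
          ∂(Measure.volumeIoiPow (Module.finrank ℝ V - 1))) •
          ∫ ω : Metric.sphere (0 : V) 1, f ω ∂μ.toSphere := by
      rw [← integral_prod_swap]
      exact integral_prod_smul (fun r : Set.Ioi (0 : ℝ) => (r : ℝ) ^ m * g r)
        fun ω : Metric.sphere (0 : V) 1 => f ω
    _ = _ := by
      rw [integral_volumeIoiPow _ fun r => r ^ m * g r]
      simp only [smul_eq_mul, pow_add, mul_assoc]

/-- The Gaussian moment `∫₀^∞ rⁿ exp (-r² / 2) dr` of the half line. -/
def halfLineMoment (n : ℕ) : ℝ :=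
  ∫ r in Set.Ioi (0 : ℝ), r ^ n * Real.exp (-(1 / 2) * r ^ 2)

lemma halfLineMoment_eq (n : ℕ) :
    halfLineMoment n =
      (1 / 2 : ℝ) ^ (-((n + 1 : ℝ) / 2)) * (1 / 2) * Real.Gamma ((n + 1) / 2) := by
  have h := integral_rpow_mul_exp_neg_mul_rpow (p := 2) (q := n) (b := 1 / 2) (by norm_num)
    (by linarith [Nat.cast_nonneg (α := ℝ) n]) (by norm_num)
  simpa only [halfLineMoment, Real.rpow_natCast, Real.rpow_two, neg_div] using h

lemma halfLineMoment_pos (n : ℕ) : 0 < halfLineMoment n := by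
  rw [halfLineMoment_eq]
  have : 0 < Real.Gamma ((n + 1 : ℝ) / 2) := Real.Gamma_pos_of_pos (by positivity)
  positivity

lemma halfLineMoment_add_two (n : ℕ) :
    halfLineMoment (n + 2) = (n + 1) * halfLineMoment n := by
  have shift : (((n + 2 : ℕ) : ℝ) + 1) / 2 = (n + 1 : ℝ) / 2 + 1 := by push_cast; ring
  rw [halfLineMoment_eq, halfLineMoment_eq, shift, Real.Gamma_add_one (by positivity), neg_add,
    Real.rpow_add (by norm_num), Real.rpow_neg_one]
  ring

lemma halfLineMoment_add_two_mul (n a : ℕ) :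
    halfLineMoment (n + 2 * a) =
      2 ^ a * (ascPochhammer ℝ a).eval ((n + 1 : ℝ) / 2) * halfLineMoment n := by
  induction a with
  | zero => simp
  | succ a ih =>
    rw [mul_add_one, ← add_assoc, halfLineMoment_add_two, ih, ascPochhammer_succ_eval]
    push_cast
    ring

variable {d : ℕ}

/-- The surface measure of the unit sphere. -/
abbrev sphereMeasure (d : ℕ) : Measure (Metric.sphere (0 : E d) 1) :=
  (volume : Measure (E d)).toSphere

variable [NeZero d]

lemma gaussInt_eq_halfLineMoment_mul {m : ℕ} {p : MvPolynomial (Fin d) ℂ}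
    (hp : p.IsHomogeneous m) :
    gaussInt (Fin d) p =
      halfLineMoment (d - 1 + m) * ∫ ω, evalAt (ω : E d) p ∂sphereMeasure d := by
  have h := integral_norm_smul_of_homogeneous (volume : Measure (E d)) (f := fun x => evalAt x p)
    (m := m) (fun r x => by simp [evalAt_real_smul hp]) fun r => Real.exp (-(1 / 2) * r ^ 2)
  rw [finrank_euclideanSpace_fin] at h
  rw [gaussInt_apply]
  exact h.trans Complex.real_smul

lemma measureReal_sphere_univ : (sphereMeasure d).real Set.univ = sphereArea d := by
  have hd : 0 < d := NeZero.pos d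
  have : 0 < Real.Gamma ((d : ℝ) / 2) := Real.Gamma_pos_of_pos (by positivity)
  have gamma_succ : Real.Gamma ((d : ℝ) / 2 + 1) = d / 2 * Real.Gamma (d / 2) :=
    Real.Gamma_add_one (by positivity)
  rw [Measure.toSphere_real_apply_univ, finrank_euclideanSpace_fin, measureReal_def,
    EuclideanSpace.volume_ball, Fintype.card_fin, ENNReal.ofReal_one, one_pow, one_mul, gamma_succ,
    ENNReal.toReal_ofReal (by positivity), Real.sqrt_eq_rpow,
    ← Real.rpow_mul_natCast Real.pi_nonneg, sphereArea]
  field_simp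

lemma gaussInt_one : gaussInt (Fin d) 1 = (halfLineMoment (d - 1) * sphereArea d : ℝ) := by
  rw [gaussInt_eq_halfLineMoment_mul (isHomogeneous_one _ _), ← measureReal_sphere_univ]
  simp

lemma integral_sphere_mul_eq_zero {k l : ℕ} (hkl : k ≠ l) {p q : MvPolynomial (Fin d) ℂ}
    (hp : p ∈ solidHarmonics d k) (hq : q ∈ solidHarmonics d l) :
    ∫ ω, evalAt (ω : E d) p * evalAt (ω : E d) q ∂sphereMeasure d = 0 := by
  rw [solidHarmonics_eq] at hp hq
  have h := gaussInt_eq_halfLineMoment_mul (hp.1.mul hq.1)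
  rw [gaussInt_mul_eq_zero hkl hp hq] at h
  simp only [map_mul] at h
  exact (mul_eq_zero.1 h.symm).resolve_left (Complex.ofReal_ne_zero.2 (halfLineMoment_pos _).ne')

lemma gaussCoeff_mul_eq_ZA_mul (k i : ℕ) :
    gaussCoeff k i * (halfLineMoment (d - 1) * sphereArea d) =
      halfLineMoment (d - 1 + (i + k)) * ZA d k i := by
  by_cases h : k ≤ i ∧ Even (i - k)
  · obtain ⟨hk, a, ha⟩ := h
    obtain rfl : i = k + 2 * a := by omega
    have dim : (((d - 1 : ℕ) : ℝ) + 1) / 2 = d / 2 := by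
      rw [Nat.cast_pred (NeZero.pos d), sub_add_cancel]
    have pochhammer_ne_zero : (ascPochhammer ℝ (k + a)).eval ((d : ℝ) / 2) ≠ 0 :=
      (ascPochhammer_pos _ _ (div_pos (Nat.cast_pos.2 (NeZero.pos d)) two_pos)).ne'
    rw [gaussCoeff_add_two_mul, ZA, if_pos ⟨hk, a, ha⟩,
      show k + 2 * a + k = 2 * (k + a) by ring, halfLineMoment_add_two_mul, dim,
      show (k + 2 * a - k) / 2 = a by omega, show 2 * (k + a) / 2 = k + a by omega,
      show k + 2 * a = k + a + a by ring, pow_add _ (k + a)]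
    push_cast
    field_simp
  · rw [gaussCoeff, if_neg h, ZA, if_neg h, Rat.cast_zero, zero_mul, mul_zero]

/-- The Funk–Hecke formula for powers. -/
theorem integral_sphere_inner_pow_mul {y : E d} (hy : ‖y‖ = 1) (i : ℕ) {k : ℕ}
    {p : MvPolynomial (Fin d) ℂ} (hp : p ∈ solidHarmonics d k) :
    ∫ ω, ((inner ℝ (ω : E d) y : ℝ) : ℂ) ^ i * evalAt (ω : E d) p ∂sphereMeasure d =
      ZA d k i * evalAt y p := by
  rw [solidHarmonics_eq] at hp
  have h := gaussInt_eq_halfLineMoment_mul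
    (((isHomogeneous_linForm (complexify y)).pow i).mul hp.1)
  rw [gaussInt_linForm_pow_mul hy i hp, gaussInt_one, one_mul] at h
  simp only [map_mul, map_pow, evalAt_linForm] at h
  have moment_ne_zero : (halfLineMoment (d - 1 + (i + k)) : ℂ) ≠ 0 :=
    Complex.ofReal_ne_zero.2 (halfLineMoment_pos _).ne'
  have key : (gaussCoeff k i : ℂ) * ((halfLineMoment (d - 1) * sphereArea d : ℝ) : ℂ) =
      halfLineMoment (d - 1 + (i + k)) * ZA d k i := by
    exact_mod_cast congrArg ((↑) : ℝ → ℂ) (gaussCoeff_mul_eq_ZA_mul (d := d) k i)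
  refine mul_left_cancel₀ moment_ne_zero (h.symm.trans ?_)
  linear_combination evalAt y p * key

end Polar

section Coefficients

variable {d : ℕ}

lemma sphereArea_nonneg (d : ℕ) : 0 ≤ sphereArea d :=
  div_nonneg (by positivity) (Real.Gamma_nonneg_of_nonneg (by positivity))

lemma ZA_nonneg [NeZero d] (k i : ℕ) : 0 ≤ ZA d k i := by
  rw [ZA]
  split_ifs
  · have := sphereArea_nonneg d
    have := ascPochhammer_pos ((i + k) / 2) ((d : ℝ) / 2) (half_pos (Nat.cast_pos.2 (NeZero.pos d)))
    positivity
  · rfl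

lemma ZA_eq_zero_of_lt {k i : ℕ} (h : i < k) : ZA d k i = 0 := by
  rw [ZA, if_neg fun h' => absurd h'.1 (by omega)]

lemma factorial_le_ascPochhammer_eval {x : ℝ} (hx : 1 ≤ x) (n : ℕ) :
    (n ! : ℝ) ≤ (ascPochhammer ℝ n).eval x := by
  induction n with
  | zero => simp
  | succ n ih =>
    rw [ascPochhammer_succ_eval, Nat.factorial_succ, mul_comm]
    push_cast
    exact mul_le_mul ih (by linarith) (by positivity) ((Nat.cast_nonneg _).trans ih)

lemma ZA_le (hd : 2 ≤ d) (k i : ℕ) : ZA d k i ≤ sphereArea d := by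
  rw [ZA]
  split_ifs with h
  · obtain ⟨hk, a, ha⟩ := h
    obtain rfl : i = k + 2 * a := by omega
    rw [show (k + 2 * a - k) / 2 = a by omega, show (k + 2 * a + k) / 2 = k + a by omega]
    have one_le : (1 : ℝ) ≤ d / 2 := by
      rw [le_div_iff₀ two_pos]
      exact_mod_cast hd
    refine div_le_of_le_mul₀ (mul_nonneg (by positivity) ?_) (sphereArea_nonneg d) ?_
    · exact (Nat.cast_nonneg _).trans (factorial_le_ascPochhammer_eval one_le _)
    refine mul_le_mul_of_nonneg_left ?_ (sphereArea_nonneg d)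
    calc
      ((k + 2 * a)! : ℝ) = (k + 2 * a).choose a * a ! * (k + a)! := by
        have h := Nat.choose_mul_factorial_mul_factorial (show a ≤ k + 2 * a by omega)
        rw [show k + 2 * a - a = k + a by omega] at h
        exact_mod_cast h.symm
      _ ≤ 2 ^ (k + 2 * a) * a ! * (ascPochhammer ℝ (k + a)).eval ((d : ℝ) / 2) := by
        gcongr
        · exact_mod_cast Nat.choose_le_two_pow _ _
        · exact factorial_le_ascPochhammer_eval one_le _
  · exact sphereArea_nonneg d

end Coefficients

section Kernel

open MeasureTheory MvPolynomial

variable {d k : ℕ} {ι : Type*} {Y : ι → E d → ℂ}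

lemma evalAt_map_conj {σ : Type*} (x : EuclideanSpace ℝ σ) (p : MvPolynomial σ ℂ) :
    evalAt x (map (starRingEnd ℂ) p) = starRingEnd ℂ (evalAt x p) := by
  induction p using MvPolynomial.induction_on with
  | C c => simp
  | add p q hp hq => simp [hp, hq]
  | mul_X p j hp => simp [hp]

lemma map_conj_mem_solidHarmonics {p : MvPolynomial (Fin d) ℂ} (hp : p ∈ solidHarmonics d k) :
    map (starRingEnd ℂ) p ∈ solidHarmonics d k := by
  refine ⟨hp.1.map _, ?_⟩
  simpa only [map_sum, pderiv_map, map_zero] using congrArg (map (starRingEnd ℂ)) hp.2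

lemma integrable_sphere {f : Metric.sphere (0 : E d) 1 → ℂ} (hf : Continuous f) :
    Integrable f (sphereMeasure d) :=
  hf.integrable_of_hasCompactSupport (HasCompactSupport.of_compactSpace f)

lemma continuous_evalAt_sphere (p : MvPolynomial (Fin d) ℂ) :
    Continuous fun ω : Metric.sphere (0 : E d) 1 => evalAt (ω : E d) p :=
  (continuous_evalAt p).comp continuous_subtype_val

lemma angularPart_of_norm_eq_one (p : MvPolynomial (Fin d) ℂ) {x : E d} (hx : ‖x‖ = 1) :
    angularPart d p x = evalAt x p := by
  change evalAt (‖x‖⁻¹ • x) p = _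
  rw [hx, inv_one, one_smul]

/-- The kernel `∑ₕ Yₖʰ(x) Yₖʰ(y)*` of a finite family of functions. For a harmonic basis it is the
reproducing kernel of the hyperspherical harmonics of the given degree. -/
def kernel [Fintype ι] (Y : ι → E d → ℂ) (x y : E d) : ℂ :=
  ∑ h, Y h x * starRingEnd ℂ (Y h y)

lemma norm_kernel_le [Fintype ι] (Y : ι → E d → ℂ) (x y : E d) :
    ‖kernel Y x y‖ ≤ ((kernel Y x x).re + (kernel Y y y).re) / 2 := by
  have diagonal (z : E d) : (kernel Y z z).re = ∑ h, ‖Y h z‖ ^ 2 := by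
    simp only [kernel, Complex.mul_conj, Complex.re_sum, Complex.ofReal_re,
      Complex.normSq_eq_norm_sq]
  rw [diagonal, diagonal, ← Finset.sum_add_distrib, Finset.sum_div]
  refine norm_sum_le_of_le _ fun h _ => ?_
  rw [norm_mul, RCLike.norm_conj]
  linarith [two_mul_le_add_sq ‖Y h x‖ ‖Y h y‖]

namespace IsHarmonicBasis

lemma exists_angularPart_eq (hY : IsHarmonicBasis d k Y) (h : ι) :
    ∃ p ∈ solidHarmonics d k, angularPart d p = Y h := by
  have mem_span : Y h ∈ Submodule.span ℂ (Set.range Y) := Submodule.subset_span ⟨h, rfl⟩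
  rw [hY.span_eq] at mem_span
  exact Submodule.mem_map.1 mem_span

lemma continuous_sphere (hY : IsHarmonicBasis d k Y) (h : ι) :
    Continuous fun ω : Metric.sphere (0 : E d) 1 => Y h ω := by
  obtain ⟨p, -, hp⟩ := hY.exists_angularPart_eq h
  simpa only [← hp, angularPart_of_norm_eq_one p (norm_eq_of_mem_sphere _)] using
    continuous_evalAt_sphere p

variable [Fintype ι]

lemma exists_kernel_eq_evalAt (hY : IsHarmonicBasis d k Y) (x : E d) :
    ∃ p ∈ solidHarmonics d k, ∀ y : E d, ‖y‖ = 1 → kernel Y x y = evalAt y p := by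
  choose p hp hpY using hY.exists_angularPart_eq
  refine ⟨∑ h, Y h x • map (starRingEnd ℂ) (p h),
    Submodule.sum_mem _ fun h _ => Submodule.smul_mem _ _ (map_conj_mem_solidHarmonics (hp h)),
    fun y hy => ?_⟩
  simp only [kernel, ← hpY, angularPart_of_norm_eq_one _ hy, map_sum, map_smul, evalAt_map_conj,
    smul_eq_mul]

lemma continuous_kernel_sphere (hY : IsHarmonicBasis d k Y) (x : E d) :
    Continuous fun ω : Metric.sphere (0 : E d) 1 => kernel Y x ω :=
  continuous_finsetSum _ fun h _ =>
    continuous_const.mul (Complex.continuous_conj.comp (hY.continuous_sphere h))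

lemma integral_mul_kernel (hY : IsHarmonicBasis d k Y) (x : E d) (h : ι) :
    ∫ ω, Y h (ω : E d) * kernel Y x ω ∂sphereMeasure d = Y h x := by
  have integrable (g : ι) : Integrable (fun ω : Metric.sphere (0 : E d) 1 =>
      Y g x * (Y h ω * starRingEnd ℂ (Y g ω))) (sphereMeasure d) :=
    integrable_sphere <| continuous_const.mul <|
      (hY.continuous_sphere h).mul (Complex.continuous_conj.comp (hY.continuous_sphere g))
  simp only [kernel, Finset.mul_sum, mul_left_comm (Y h _)]
  rw [integral_finsetSum _ fun g _ => integrable g,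
    Finset.sum_eq_single_of_mem h (Finset.mem_univ h)
    fun g _ hg => by rw [integral_const_mul, hY.orthogonal h g hg.symm, mul_zero],
    integral_const_mul, hY.norm_one, mul_one]

theorem integral_evalAt_mul_kernel (hY : IsHarmonicBasis d k Y) {p : MvPolynomial (Fin d) ℂ}
    (hp : p ∈ solidHarmonics d k) {x : E d} (hx : ‖x‖ = 1) :
    ∫ ω, evalAt (ω : E d) p * kernel Y x ω ∂sphereMeasure d = evalAt x p := by
  have mem_span : angularPart d p ∈ Submodule.span ℂ (Set.range Y) :=
    hY.span_eq ▸ Submodule.mem_map_of_mem hp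
  obtain ⟨a, ha⟩ := (Submodule.mem_span_range_iff_exists_fun ℂ).1 mem_span
  have expand {y : E d} (hy : ‖y‖ = 1) : evalAt y p = ∑ h, a h * Y h y := by
    simp only [← angularPart_of_norm_eq_one p hy, ← ha, Finset.sum_apply, Pi.smul_apply,
      smul_eq_mul]
  have integrable (h : ι) : Integrable (fun ω : Metric.sphere (0 : E d) 1 =>
      a h * (Y h ω * kernel Y x ω)) (sphereMeasure d) :=
    integrable_sphere <| continuous_const.mul <|
      (hY.continuous_sphere h).mul (hY.continuous_kernel_sphere x)
  simp only [expand (norm_eq_of_mem_sphere _), expand hx, Finset.sum_mul, mul_assoc]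
  rw [integral_finsetSum _ fun h _ => integrable h]
  simp only [integral_const_mul, hY.integral_mul_kernel]

variable [NeZero d]

lemma integral_evalAt_mul_kernel_of_ne (hY : IsHarmonicBasis d k Y) {l : ℕ} (hlk : l ≠ k)
    {p : MvPolynomial (Fin d) ℂ} (hp : p ∈ solidHarmonics d l) (x : E d) :
    ∫ ω, evalAt (ω : E d) p * kernel Y x ω ∂sphereMeasure d = 0 := by
  obtain ⟨q, hq, hqx⟩ := hY.exists_kernel_eq_evalAt x
  simp only [hqx _ (norm_eq_of_mem_sphere _)]
  exact integral_sphere_mul_eq_zero hlk hp hq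

lemma integral_inner_pow_mul_kernel (hY : IsHarmonicBasis d k Y) (i : ℕ) (x : E d) {y : E d}
    (hy : ‖y‖ = 1) :
    ∫ ω, ((inner ℝ (ω : E d) y : ℝ) : ℂ) ^ i * kernel Y x ω ∂sphereMeasure d =
      ZA d k i * kernel Y x y := by
  obtain ⟨q, hq, hqx⟩ := hY.exists_kernel_eq_evalAt x
  simp only [hqx _ (norm_eq_of_mem_sphere _), hqx y hy]
  exact integral_sphere_inner_pow_mul hy i hq

end IsHarmonicBasis

variable [NeZero d] {ι : ℕ → Type*} [∀ k, Fintype (ι k)] {Y : (k : ℕ) → ι k → E d → ℂ}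

lemma evalAt_eq_sum_integral_mul_kernel (hY : ∀ k, IsHarmonicBasis d k (Y k)) {n : ℕ}
    {f : MvPolynomial (Fin d) ℂ} (hf : f.IsHomogeneous n) {x : E d} (hx : ‖x‖ = 1) :
    evalAt x f = ∑ k ∈ Finset.range (n + 1),
      ∫ ω, evalAt (ω : E d) f * kernel (Y k) x ω ∂sphereMeasure d := by
  have integrable (p : MvPolynomial (Fin d) ℂ) (k : ℕ) :
      Integrable (fun ω : Metric.sphere (0 : E d) 1 => evalAt (ω : E d) p * kernel (Y k) x ω)
        (sphereMeasure d) :=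
    integrable_sphere ((continuous_evalAt_sphere p).mul ((hY k).continuous_kernel_sphere x))
  rw [← mem_homogeneousSubmodule, homogeneousSubmodule_eq_harmonicSpan] at hf
  induction hf using Submodule.span_induction with
  | mem f hf =>
    obtain ⟨j, m, rfl, h, hh, rfl⟩ := hf
    have on_sphere {y : E d} (hy : ‖y‖ = 1) : evalAt y (normSq (Fin d) ℂ ^ j * h) = evalAt y h := by
      rw [map_mul, map_pow, evalAt_normSq, hy, Complex.ofReal_one, one_pow, one_pow, one_mul]
    rw [← solidHarmonics_eq] at hh
    simp only [on_sphere (norm_eq_of_mem_sphere _), on_sphere hx]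
    rw [Finset.sum_eq_single_of_mem m (Finset.mem_range.2 (by omega))
      fun k _ hk => (hY k).integral_evalAt_mul_kernel_of_ne hk.symm hh x,
      (hY m).integral_evalAt_mul_kernel hh hx]
  | zero => simp
  | add f g _ _ hf hg =>
    simp only [map_add, add_mul, hf, hg, ← Finset.sum_add_distrib]
    exact Finset.sum_congr rfl fun k _ => (integral_add (integrable f k) (integrable g k)).symm
  | smul c f _ hf =>
    simp only [map_smul, smul_eq_mul, mul_assoc, integral_const_mul, ← Finset.mul_sum, hf]

/-- The addition theorem, for powers of the inner product in place of Gegenbauer polynomials. -/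
theorem inner_pow_eq_sum_kernel (hY : ∀ k, IsHarmonicBasis d k (Y k)) (i : ℕ) {x y : E d}
    (hx : ‖x‖ = 1) (hy : ‖y‖ = 1) :
    ((inner ℝ x y : ℝ) : ℂ) ^ i = ∑ k ∈ Finset.range (i + 1), ZA d k i * kernel (Y k) x y := by
  have homogeneous : (linForm (complexify y) ^ i).IsHomogeneous i := by
    simpa using (isHomogeneous_linForm (complexify y)).pow i
  have h := evalAt_eq_sum_integral_mul_kernel hY homogeneous hx
  simp only [map_pow, evalAt_linForm] at h
  simpa only [(hY _).integral_inner_pow_mul_kernel i x hy] using h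

lemma sum_ZA_mul_norm_kernel_le (hY : ∀ k, IsHarmonicBasis d k (Y k)) (i : ℕ) {x y : E d}
    (hx : ‖x‖ = 1) (hy : ‖y‖ = 1) :
    ∑ k ∈ Finset.range (i + 1), ZA d k i * ‖kernel (Y k) x y‖ ≤ 1 := by
  have diagonal {z : E d} (hz : ‖z‖ = 1) :
      ∑ k ∈ Finset.range (i + 1), ZA d k i * (kernel (Y k) z z).re = 1 := by
    have h := congrArg Complex.re (inner_pow_eq_sum_kernel hY i hz hz)
    simpa [real_inner_self_eq_norm_sq, hz, Complex.re_ofReal_mul] using h.symm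
  calc
    ∑ k ∈ Finset.range (i + 1), ZA d k i * ‖kernel (Y k) x y‖
        ≤ ∑ k ∈ Finset.range (i + 1),
            ZA d k i * (((kernel (Y k) x x).re + (kernel (Y k) y y).re) / 2) := by
      gcongr with k
      · exact ZA_nonneg k i
      · exact norm_kernel_le _ _ _
    _ = (∑ k ∈ Finset.range (i + 1), ZA d k i * (kernel (Y k) x x).re +
          ∑ k ∈ Finset.range (i + 1), ZA d k i * (kernel (Y k) y y).re) / 2 := by
      simp only [mul_div_assoc', mul_add, ← Finset.sum_div, Finset.sum_add_distrib]
    _ = 1 := by rw [diagonal hx, diagonal hy, add_self_div_two]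

end Kernel

section ChainRule

lemma B_zero_right (n : ℕ) : B n 0 = if n = 0 then 1 else 0 := if_pos rfl

lemma B_eq_zero_of_lt {n m : ℕ} (h : n < m) : B n m = 0 := by
  rw [B, if_neg (by omega), if_pos h]

lemma B_add_succ (m a : ℕ) :
    B (m + 1 + a) (m + 1) =
      (-1) ^ a * ((2 * a - 1)‼ : ℝ) / 2 ^ (m + 1 + a) * ((m + 2 * a).choose m : ℝ) := by
  have sign : (-1 : ℝ) ^ (m + 1 + a + (m + 1)) = (-1) ^ a := by
    rw [show m + 1 + a + (m + 1) = 2 * (m + 1) + a by ring, pow_add, pow_mul, neg_one_sq, one_pow,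
      one_mul]
  rw [B, if_neg m.succ_ne_zero, if_neg (by omega), sign,
    show 2 * (m + 1 + a) - 2 * (m + 1) - 1 = 2 * a - 1 by omega,
    show 2 * (m + 1 + a) - (m + 1) - 1 = m + 2 * a by omega, Nat.add_sub_cancel]

lemma B_self (n : ℕ) : B n n = 1 / 2 ^ n := by
  cases n with
  | zero => simp [B_zero_right]
  | succ n => simpa using B_add_succ n 0

lemma B_succ_zero (n : ℕ) : B (n + 1) 0 = -(n : ℝ) * B n 0 := by
  cases n <;> simp [B_zero_right]

lemma B_add_two_succ (m a : ℕ) :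
    B (m + 1 + a + 1) (m + 1) =
      (-1) ^ (a + 1) * ((2 * a + 1) * (2 * a - 1)‼ : ℝ) / 2 ^ (m + 1 + a + 1) *
        ((m + 2 * a + 2).choose m : ℝ) := by
  rw [add_assoc (m + 1), B_add_succ, show 2 * (a + 1) - 1 = 2 * a + 1 by omega,
    Nat.doubleFactorial_add_one, ← add_assoc (m + 1), mul_add_one, ← add_assoc m]
  push_cast
  rfl

lemma choose_mul_add_two (m a : ℕ) :
    ((m + 2 * a + 1).choose (m + 1) : ℝ) * (m + 2 * a + 2) =
      (m + 2 * a + 2).choose (m + 1) * (2 * a + 1) := by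
  have h := Nat.choose_mul_succ_eq (m + 2 * a + 1) (m + 1)
  rw [show m + 2 * a + 1 + 1 - (m + 1) = 2 * a + 1 by omega] at h
  exact_mod_cast h

theorem B_succ_succ (n m : ℕ) :
    B (n + 1) (m + 1) = 1 / 2 * B n m + (((m + 1 : ℕ) : ℝ) / 2 - n) * B n (m + 1) := by
  rcases lt_trichotomy n m with h | rfl | h
  · rw [B_eq_zero_of_lt h, B_eq_zero_of_lt (Nat.succ_lt_succ h),
      B_eq_zero_of_lt (h.trans m.lt_succ_self)]
    ring
  · rw [B_self, B_self, B_eq_zero_of_lt n.lt_succ_self, pow_succ]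
    ring
  obtain ⟨a, rfl⟩ := Nat.exists_eq_add_of_le (Nat.succ_le_of_lt h)
  rw [B_add_two_succ, B_add_succ]
  cases m with
  | zero =>
    rw [B_zero_right, if_neg (by omega)]
    simp only [Nat.choose_zero_right, pow_succ]
    push_cast
    field_simp
    ring
  | succ m =>
    have pascal : ((m + 2 * a + 3).choose (m + 1) : ℝ) =
        (m + 2 * a + 2).choose m + (m + 2 * a + 2).choose (m + 1) := by
      exact_mod_cast Nat.choose_succ_succ (m + 2 * a + 2) m
    rw [show m + 1 + 1 + a = m + 1 + a + 1 by ring, B_add_two_succ,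
      show m + 1 + 2 * a + 2 = m + 2 * a + 3 by ring, pascal,
      show m + 1 + 2 * a = m + 2 * a + 1 by ring, pow_succ _ (m + 1 + a + 1), pow_succ _ a]
    push_cast
    field_simp
    linear_combination choose_mul_add_two m a

lemma sum_B_succ_smul {F : Type*} [AddCommGroup F] [Module ℝ F] (n : ℕ) (g : ℕ → F) :
    ∑ m ∈ Finset.range (n + 2), B (n + 1) m • g m =
      ∑ m ∈ Finset.range (n + 1), B n m • ((m / 2 - n : ℝ) • g m + (1 / 2 : ℝ) • g (m + 1)) := by
  have shift : ∑ m ∈ Finset.range (n + 1), B n m • (m / 2 - n : ℝ) • g m =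
      ∑ m ∈ Finset.range (n + 1), B n (m + 1) • ((m + 1 : ℕ) / 2 - n : ℝ) • g (m + 1) +
        B n 0 • ((0 : ℕ) / 2 - n : ℝ) • g 0 := by
    rw [← Finset.sum_range_succ' fun m => B n m • (m / 2 - n : ℝ) • g m,
      Finset.sum_range_succ _ (n + 1), B_eq_zero_of_lt n.lt_succ_self, zero_smul, add_zero]
  rw [Finset.sum_range_succ', B_succ_zero]
  simp only [smul_add, Finset.sum_add_distrib, shift]
  rw [add_right_comm, ← Finset.sum_add_distrib]
  congr 1
  · refine Finset.sum_congr rfl fun m _ => ?_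
    rw [B_succ_succ]
    module
  · push_cast
    module

variable {F : Type*} [NormedAddCommGroup F] [NormedSpace ℝ F]

lemma hasDerivAt_zpow_sqrt_smul_comp_sqrt {g : ℝ → F} {g' : F} {r ε : ℝ} (hε : -1 < ε)
    (hg : HasDerivAt g g' (r * √(1 + ε))) (l : ℤ) :
    HasDerivAt (fun ε => √(1 + ε) ^ l • g (r * √(1 + ε)))
      ((l / 2 * √(1 + ε) ^ (l - 2)) • g (r * √(1 + ε)) + (r / 2 * √(1 + ε) ^ (l - 1)) • g') ε := by
  have sqrt_ne_zero : √(1 + ε) ≠ 0 := (Real.sqrt_pos.2 (by linarith)).ne'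
  have deriv_sqrt : HasDerivAt (fun ε => √(1 + ε)) (1 / (2 * √(1 + ε))) ε := by
    simpa using ((hasDerivAt_id ε).const_add 1).sqrt (by simp; linarith)
  have deriv_zpow := (hasDerivAt_zpow l _ (Or.inl sqrt_ne_zero)).comp ε deriv_sqrt
  refine (deriv_zpow.smul (hg.scomp ε (deriv_sqrt.const_mul r))).congr_deriv ?_
  have l_sub_one : √(1 + ε) ^ (l - 1) = √(1 + ε) ^ (l - 2) * √(1 + ε) := by
    rw [← zpow_add_one₀ sqrt_ne_zero]; ring_nf
  have l_eq : √(1 + ε) ^ l = √(1 + ε) ^ (l - 1) * √(1 + ε) := by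
    rw [← zpow_add_one₀ sqrt_ne_zero]; ring_nf
  simp only [Function.comp_def]
  rw [l_eq, l_sub_one, smul_smul, add_comm]
  congr 2 <;> field_simp

theorem iteratedDeriv_comp_mul_sqrt [CompleteSpace F] {K : ℝ → F} {r : ℝ} (hr : 0 < r)
    (hK : AnalyticOnNhd ℝ K (Set.Ioi 0)) (n : ℕ) {ε : ℝ} (hε : -1 < ε) :
    iteratedDeriv n (fun ε => K (r * √(1 + ε))) ε =
      ∑ m ∈ Finset.range (n + 1), (B n m * r ^ m) •
        √(1 + ε) ^ ((m : ℤ) - 2 * n) • iteratedDeriv m K (r * √(1 + ε)) := by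
  induction n generalizing ε with
  | zero => simp [B_zero_right]
  | succ n ih =>
    have eventually_ih : iteratedDeriv n (fun ε => K (r * √(1 + ε))) =ᶠ[nhds ε] _ :=
      Filter.eventuallyEq_of_mem (Ioi_mem_nhds hε) fun δ hδ => ih hδ
    have hasDerivAt_iteratedDeriv (m : ℕ) : HasDerivAt (iteratedDeriv m K)
        (iteratedDeriv (m + 1) K (r * √(1 + ε))) (r * √(1 + ε)) := by
      have analytic := hK.iterated_deriv m (r * √(1 + ε))
        (mul_pos hr (Real.sqrt_pos.2 (by linarith)))
      rw [← iteratedDeriv_eq_iterate] at analytic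
      rw [iteratedDeriv_succ]
      exact analytic.differentiableAt.hasDerivAt
    have hasDerivAt_sum := HasDerivAt.fun_sum (u := Finset.range (n + 1)) fun m _ =>
      (hasDerivAt_zpow_sqrt_smul_comp_sqrt hε (hasDerivAt_iteratedDeriv m)
        ((m : ℤ) - 2 * n)).fun_const_smul (B n m * r ^ m)
    rw [iteratedDeriv_succ, eventually_ih.deriv_eq, hasDerivAt_sum.deriv]
    simp only [mul_smul (B _ _)]
    rw [sum_B_succ_smul]
    refine Finset.sum_congr rfl fun m _ => ?_
    rw [show (m : ℤ) - 2 * n - 2 = m - 2 * (n + 1 : ℕ) by push_cast; ring,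
      show (m : ℤ) - 2 * n - 1 = (m + 1 : ℕ) - 2 * (n + 1 : ℕ) by push_cast; ring]
    push_cast
    module

end ChainRule

section Taylor

open Filter Topology

/-- The Taylor coefficients of `f` at `0`. -/
def taylorCoeff (f : ℝ → ℂ) (n : ℕ) : ℂ := iteratedDeriv n f 0 / (n ! : ℂ)

/-- The Taylor series of `f` at `0`, as a power series in a complex variable. -/
def taylorSeries (f : ℝ → ℂ) : FormalMultilinearSeries ℂ ℂ ℂ :=
  FormalMultilinearSeries.ofScalars ℂ (taylorCoeff f)

lemma taylorRadius_eq (K : ℝ → ℂ) (r : ℝ) :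
    taylorRadius K r = (taylorSeries fun ε => K (r * √(1 + ε))).radius := rfl

variable {f : ℝ → ℂ} {s : Set ℝ} {y : ℝ}

lemma summable_norm_taylorCoeff_mul_pow (hy₀ : 0 ≤ y)
    (hy : ENNReal.ofReal y < (taylorSeries f).radius) :
    Summable fun n => ‖taylorCoeff f n‖ * y ^ n := by
  have h := FormalMultilinearSeries.summable_norm_mul_pow _ (r := y.toNNReal) hy
  simpa only [taylorSeries, FormalMultilinearSeries.ofScalars_norm, Real.coe_toNNReal _ hy₀] using h

lemma ofReal_mem_eball {ρ : ENNReal} (hy : ENNReal.ofReal |y| < ρ) :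
    (y : ℂ) ∈ Metric.eball (0 : ℂ) ρ := by
  rwa [Metric.mem_eball, edist_zero_right, ← ofReal_norm, Complex.norm_real]

lemma hasSum_taylorSeries_sum (hy : ENNReal.ofReal |y| < (taylorSeries f).radius) :
    HasSum (fun n => taylorCoeff f n * (y : ℂ) ^ n) ((taylorSeries f).sum y) := by
  have h := (taylorSeries f).hasSum (ofReal_mem_eball hy)
  simpa [taylorSeries, FormalMultilinearSeries.ofScalars_apply_eq, mul_comm] using h

lemma analyticAt_taylorSeries_sum (hy : ENNReal.ofReal |y| < (taylorSeries f).radius) :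
    AnalyticAt ℝ (fun y : ℝ => (taylorSeries f).sum y) y :=
  (((taylorSeries f).hasFPowerSeriesOnBall (bot_le.trans_lt hy)).analyticAt_of_mem
    (ofReal_mem_eball hy)).restrictScalars.comp (Complex.ofRealCLM.analyticAt y)

lemma eventually_ofReal_abs_lt {ρ : ENNReal} (hy : ENNReal.ofReal |y| < ρ) :
    ∀ᶠ z in 𝓝 y, ENNReal.ofReal |z| < ρ :=
  (ENNReal.continuous_ofReal.comp continuous_abs).continuousAt.eventually_lt continuousAt_const hy

lemma eventuallyEq_taylorSeries_sum (hf : AnalyticAt ℝ f 0) (hR : 0 < (taylorSeries f).radius) :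
    f =ᶠ[𝓝 0] fun y => (taylorSeries f).sum y := by
  obtain ⟨q, ρ, hq⟩ := hf
  filter_upwards [eventually_ofReal_abs_lt (by simpa using hR), Metric.eball_mem_nhds 0 hq.r_pos]
    with y hy hyq
  have h := hq.hasSum_iteratedFDeriv hyq
  rw [zero_add] at h
  refine h.unique ((hasSum_taylorSeries_sum hy).congr_fun fun n => ?_)
  rw [iteratedFDeriv_apply_eq_iteratedDeriv_mul_prod, Finset.prod_const, Finset.card_fin,
    Complex.real_smul, Complex.real_smul, taylorCoeff]
  push_cast
  ring

lemma eqOn_taylorSeries_sum (hs : s.OrdConnected) (hs₀ : (0 : ℝ) ∈ s)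
    (hf : AnalyticOnNhd ℝ f s) :
    Set.EqOn f (fun y => (taylorSeries f).sum y)
      (s ∩ {y | ENNReal.ofReal |y| < (taylorSeries f).radius}) := by
  have ordConnected : {y : ℝ | ENNReal.ofReal |y| < (taylorSeries f).radius}.OrdConnected :=
    ⟨fun a ha b hb y hy => (ENNReal.ofReal_le_ofReal (abs_le_max_abs_abs hy.1 hy.2)).trans_lt
      (by rcases max_choice |a| |b| with h | h <;> rwa [h])⟩
  intro y hy
  have hR : 0 < (taylorSeries f).radius := bot_le.trans_lt hy.2
  exact AnalyticOnNhd.eqOn_of_preconnected_of_eventuallyEq (fun z hz => hf z hz.1)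
    (fun z hz => analyticAt_taylorSeries_sum hz.2) (hs.inter ordConnected).isPreconnected
    ⟨hs₀, by simpa using hR⟩ (eventuallyEq_taylorSeries_sum (hf 0 hs₀) hR) hy

/-- By the identity theorem the Taylor series represents the function along the whole interval, and
both sides are continuous up to its end points. -/
theorem hasSum_taylorCoeff (hs : s.OrdConnected) (hs₀ : (0 : ℝ) ∈ s) (hf : AnalyticOnNhd ℝ f s)
    (hys : y ∈ closure s) (hfy : ContinuousWithinAt f s y)
    (hy : ENNReal.ofReal |y| < (taylorSeries f).radius) :
    HasSum (fun n => taylorCoeff f n * (y : ℂ) ^ n) (f y) := by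
  have : (𝓝[s] y).NeBot := mem_closure_iff_nhdsWithin_neBot.1 hys
  have eventuallyEq : f =ᶠ[𝓝[s] y] fun y => (taylorSeries f).sum y := by
    filter_upwards [self_mem_nhdsWithin, (eventually_ofReal_abs_lt hy).filter_mono
      nhdsWithin_le_nhds] with z hzs hz using eqOn_taylorSeries_sum hs hs₀ hf ⟨hzs, hz⟩
  have value : f y = (taylorSeries f).sum y :=
    tendsto_nhds_unique (hfy.tendsto.congr' eventuallyEq)
      ((analyticAt_taylorSeries_sum hy).continuousAt.tendsto.mono_left nhdsWithin_le_nhds)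
  rw [value]
  exact hasSum_taylorSeries_sum hy

variable {K : ℝ → ℂ} {r ε : ℝ}

lemma taylorCoeff_comp_mul_sqrt (hr : 0 < r) (hK : AnalyticOnNhd ℝ K (Set.Ioi 0)) (n : ℕ) :
    taylorCoeff (fun ε => K (r * √(1 + ε))) n =
      (∑ m ∈ Finset.range (n + 1), (B n m : ℂ) * (r : ℂ) ^ m * iteratedDeriv m K r) /
        (n ! : ℂ) := by
  rw [taylorCoeff, iteratedDeriv_comp_mul_sqrt hr hK n (by norm_num)]
  simp

lemma analyticAt_comp_mul_sqrt (hr : 0 < r) (hK : AnalyticOnNhd ℝ K (Set.Ioi 0)) (hε : -1 < ε) :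
    AnalyticAt ℝ (fun ε => K (r * √(1 + ε))) ε := by
  have one_add_pos : 0 < 1 + ε := by linarith
  have analytic_sqrt : AnalyticAt ℝ Real.sqrt (1 + ε) :=
    (Real.contDiffAt_sqrt one_add_pos.ne').analyticAt
  exact AnalyticAt.fun_comp (hK _ (mul_pos hr (Real.sqrt_pos.2 one_add_pos)))
    (analyticAt_const.mul (analytic_sqrt.comp (analyticAt_const.add analyticAt_id)))

lemma continuousWithinAt_comp_mul_sqrt (hr : 0 < r) (hK : ContinuousWithinAt K (Set.Ioi 0) 0) :
    ContinuousWithinAt (fun ε => K (r * √(1 + ε))) (Set.Ioi (-1)) (-1) := by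
  have inner : Continuous fun ε : ℝ => r * √(1 + ε) := by fun_prop
  refine ContinuousWithinAt.comp (t := Set.Ioi 0) (by simpa using hK) inner.continuousWithinAt
    fun ε hε => mul_pos hr (Real.sqrt_pos.2 ?_)
  linarith [Set.mem_Ioi.1 hε]

theorem hasSum_taylorCoeff_comp_mul_sqrt (hr : 0 < r) (hK : AnalyticOnNhd ℝ K (Set.Ioi 0))
    (hε : -1 ≤ ε) (hK₀ : ε = -1 → ContinuousWithinAt K (Set.Ioi 0) 0)
    (hR : ENNReal.ofReal |ε| < taylorRadius K r) :
    HasSum (fun n => taylorCoeff (fun ε => K (r * √(1 + ε))) n * (ε : ℂ) ^ n)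
      (K (r * √(1 + ε))) := by
  refine hasSum_taylorCoeff (f := fun ε => K (r * √(1 + ε))) Set.ordConnected_Ioi
    (show (0 : ℝ) ∈ Set.Ioi (-1) by simp) (fun δ hδ => analyticAt_comp_mul_sqrt hr hK hδ)
    (by simpa using hε) ?_ hR
  rcases hε.eq_or_lt with rfl | hε
  · exact continuousWithinAt_comp_mul_sqrt hr (hK₀ rfl)
  · exact (analyticAt_comp_mul_sqrt hr hK hε).continuousAt.continuousWithinAt

end Taylor

section Rearrangement

open Filter Topology

variable {α β : Type*} {g : α → β} {F : β → Finset α}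

lemma hasSum_sum_fiber {M : Type*} [AddCommMonoid M] [TopologicalSpace M] [ContinuousAdd M]
    [RegularSpace M] {f : α → M} {S : M} (hF : ∀ {b a}, a ∈ F b ↔ g a = b) (hf : HasSum f S) :
    HasSum (fun b => ∑ a ∈ F b, f a) S := by
  refine ((Equiv.sigmaFiberEquiv g).hasSum_iff.2 hf).sigma fun b => ?_
  rw [← Finset.sum_finset_coe f]
  exact (Equiv.subtypeEquivRight fun _ => hF).hasSum_iff.1 (hasSum_fintype _)

lemma summable_of_summable_sum_fiber {f : α → ℝ} (hF : ∀ {b a}, a ∈ F b ↔ g a = b)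
    (hf₀ : ∀ a, 0 ≤ f a) (hf : Summable fun b => ∑ a ∈ F b, f a) : Summable f := by
  have hasSum_fiber (b : β) : HasSum (fun a : {a // g a = b} => f a) (∑ a ∈ F b, f a) := by
    rw [← Finset.sum_finset_coe f]
    exact (Equiv.subtypeEquivRight fun _ => hF).hasSum_iff.1 (hasSum_fintype _)
  refine (Equiv.sigmaFiberEquiv g).summable_iff.1 ((summable_sigma_of_nonneg fun _ => hf₀ _).2 ?_)
  exact ⟨fun b => (hasSum_fiber b).summable, hf.congr fun b => (hasSum_fiber b).tsum_eq.symm⟩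

theorem hasSum_tsum_mul_of_tsum_norm_le {R : Type*} [NormedRing R] [CompleteSpace R] {a : α → R}
    {w : α → β → R} {C : ℝ} {S : R} (ha : Summable fun p => ‖a p‖)
    (hw : ∀ p, Summable fun q => ‖w p q‖) (hC : ∀ p, ∑' q, ‖w p q‖ ≤ C)
    (hS : HasSum (fun p => a p * ∑' q, w p q) S) :
    HasSum (fun q => ∑' p, a p * w p q) S := by
  have nonneg : 0 ≤ fun x : α × β => ‖a x.1‖ * ‖w x.1 x.2‖ := fun x =>
    mul_nonneg (norm_nonneg _) (norm_nonneg _)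
  have summable_bound : Summable fun x : α × β => ‖a x.1‖ * ‖w x.1 x.2‖ := by
    refine (summable_prod_of_nonneg nonneg).2 ⟨fun p => (hw p).mul_left ‖a p‖, ?_⟩
    refine (ha.mul_right C).of_nonneg_of_le (fun p => tsum_nonneg fun q => nonneg (p, q))
      fun p => ?_
    exact tsum_mul_left.trans_le (mul_le_mul_of_nonneg_left (hC p) (norm_nonneg (a p)))
  have summable : Summable fun x : α × β => a x.1 * w x.1 x.2 :=
    .of_norm_bounded summable_bound fun x => norm_mul_le _ _
  have total := summable.hasSum.prod_fiberwise fun p => (hw p).of_norm.hasSum.mul_left (a p)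
  rw [hS.unique total]
  have swapped := (Equiv.prodComm β α).hasSum_iff.2 summable.hasSum
  exact swapped.prod_fiberwise fun q => (swapped.summable.prod_factor q).hasSum

variable {𝕜 : Type*} [NormedField 𝕜] {c : ℕ → 𝕜} {a b : 𝕜}

lemma summable_norm_binomial (hc : Summable fun n => ‖c n‖ * (‖a‖ + ‖b‖) ^ n) :
    Summable fun p : ℕ × ℕ => ‖c (p.1 + p.2) * (p.1 + p.2).choose p.1 * a ^ p.1 * b ^ p.2‖ := by
  refine Summable.of_nonneg_of_le (fun _ => norm_nonneg _) (fun p => ?_)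
    (summable_of_summable_sum_fiber (g := fun p : ℕ × ℕ => p.1 + p.2)
      Finset.HasAntidiagonal.mem_antidiagonal
      (f := fun p => ‖c (p.1 + p.2)‖ * ((p.1 + p.2).choose p.1 * (‖a‖ ^ p.1 * ‖b‖ ^ p.2)))
      (fun _ => by positivity) (hc.congr fun n => ?_))
  · have norm_choose := Nat.norm_cast_le (α := 𝕜) ((p.1 + p.2).choose p.1)
    rw [norm_one, mul_one] at norm_choose
    rw [norm_mul, norm_mul, norm_mul, norm_pow, norm_pow, mul_assoc, mul_assoc]
    gcongr
  · rw [(Commute.all _ _).add_pow', Finset.mul_sum]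
    refine Finset.sum_congr rfl fun p hp => ?_
    rw [Finset.HasAntidiagonal.mem_antidiagonal.1 hp, nsmul_eq_mul]

theorem hasSum_binomial [CompleteSpace 𝕜] {S : 𝕜}
    (hc : Summable fun n => ‖c n‖ * (‖a‖ + ‖b‖) ^ n)
    (hS : HasSum (fun n => c n * (a + b) ^ n) S) :
    HasSum (fun p : ℕ × ℕ => c (p.1 + p.2) * (p.1 + p.2).choose p.1 * a ^ p.1 * b ^ p.2) S := by
  have hasSum := (summable_norm_binomial hc).of_norm.hasSum
  have grouped := hasSum_sum_fiber (g := fun p : ℕ × ℕ => p.1 + p.2)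
    Finset.HasAntidiagonal.mem_antidiagonal hasSum
  rw [hS.unique (grouped.congr_fun fun n => ?_)]
  · exact hasSum
  · rw [(Commute.all _ _).add_pow', Finset.mul_sum]
    refine Finset.sum_congr rfl fun p hp => ?_
    rw [Finset.HasAntidiagonal.mem_antidiagonal.1 hp, nsmul_eq_mul]
    ring

end Rearrangement

section Expansion

/-- The coefficient of `tⁱ` in the `(i, q)`-term of the binomial expansion of
`∑ₙ cₙ (s² - 2 s t)ⁿ`, where `n = i + q`. -/
def expandTerm (c : ℕ → ℂ) (s : ℝ) (p : ℕ × ℕ) : ℂ :=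
  c (p.1 + p.2) * (p.1 + p.2).choose p.1 * (-2 * s) ^ p.1 * (s ^ 2) ^ p.2

variable {c : ℕ → ℂ} {s : ℝ}

lemma norm_mul_add_norm_sq_le (hs : 0 ≤ s) {t : ℝ} (ht : |t| ≤ 1) :
    ‖(-2 * s * t : ℂ)‖ + ‖(s ^ 2 : ℂ)‖ ≤ s * (s + 2) := by
  simp only [norm_mul, norm_neg, norm_pow, Complex.norm_real, Real.norm_eq_abs, abs_of_nonneg hs,
    Complex.norm_ofNat]
  nlinarith

lemma summable_norm_mul_norm_add_norm_pow (hs : 0 ≤ s)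
    (hc : Summable fun n => ‖c n‖ * (s * (s + 2)) ^ n) {t : ℝ} (ht : |t| ≤ 1) :
    Summable fun n => ‖c n‖ * (‖(-2 * s * t : ℂ)‖ + ‖(s ^ 2 : ℂ)‖) ^ n := by
  refine hc.of_nonneg_of_le (fun n => by positivity) fun n => ?_
  gcongr
  exact norm_mul_add_norm_sq_le hs ht

lemma summable_norm_expandTerm (hs : 0 ≤ s) (hc : Summable fun n => ‖c n‖ * (s * (s + 2)) ^ n) :
    Summable fun p => ‖expandTerm c s p‖ := by
  have h := summable_norm_mul_norm_add_norm_pow hs hc (t := 1) (by simp)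
  rw [Complex.ofReal_one, mul_one] at h
  exact summable_norm_binomial h

lemma hasSum_expandTerm (hs : 0 ≤ s) (hc : Summable fun n => ‖c n‖ * (s * (s + 2)) ^ n) {t : ℝ}
    (ht : |t| ≤ 1) {S : ℂ} (hS : HasSum (fun n => c n * ((s * (s - 2 * t) : ℝ) : ℂ) ^ n) S) :
    HasSum (fun p => expandTerm c s p * (t : ℂ) ^ p.1) S := by
  have split : ((s * (s - 2 * t) : ℝ) : ℂ) = -2 * s * t + s ^ 2 := by push_cast; ring
  rw [split] at hS
  refine (hasSum_binomial (summable_norm_mul_norm_add_norm_pow hs hc ht) hS).congr_fun fun p => ?_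
  rw [expandTerm, mul_pow _ (t : ℂ)]
  ring

variable {d : ℕ}

lemma summable_expandTerm_mul_ZA (hd : 2 ≤ d) (hs : 0 ≤ s)
    (hc : Summable fun n => ‖c n‖ * (s * (s + 2)) ^ n) (k : ℕ) :
    Summable fun p : ℕ × ℕ => expandTerm c s p * (ZA d k p.1 : ℂ) := by
  have : NeZero d := ⟨by omega⟩
  refine .of_norm_bounded ((summable_norm_expandTerm hs hc).mul_right (sphereArea d)) fun p => ?_
  rw [norm_mul, Complex.norm_real, Real.norm_of_nonneg (ZA_nonneg _ _)]
  exact mul_le_mul_of_nonneg_left (ZA_le hd _ _) (norm_nonneg _)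

theorem hasSum_kernel_mul [NeZero d] {ι : ℕ → Type*} [∀ k, Fintype (ι k)]
    {Y : (k : ℕ) → ι k → E d → ℂ} (hY : ∀ k, IsHarmonicBasis d k (Y k)) {x y : E d}
    (hx : ‖x‖ = 1) (hy : ‖y‖ = 1) (hs : 0 ≤ s)
    (hc : Summable fun n => ‖c n‖ * (s * (s + 2)) ^ n) {S : ℂ}
    (hS : HasSum (fun n => c n * ((s * (s - 2 * inner ℝ x y) : ℝ) : ℂ) ^ n) S) :
    HasSum (fun k => kernel (Y k) x y * ∑' p : ℕ × ℕ, expandTerm c s p * (ZA d k p.1 : ℂ)) S := by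
  have abs_inner_le : |inner ℝ x y| ≤ 1 := by
    simpa [hx, hy] using abs_real_inner_le_norm x y
  set w : ℕ × ℕ → ℕ → ℂ := fun p k => ZA d k p.1 * kernel (Y k) x y with w_def
  have w_eq_zero (p : ℕ × ℕ) (k : ℕ) (hk : k ∉ Finset.range (p.1 + 1)) : w p k = 0 := by
    simp only [w_def]
    rw [ZA_eq_zero_of_lt (by simpa using hk), Complex.ofReal_zero, zero_mul]
  have norm_w_eq_zero (p : ℕ × ℕ) (k : ℕ) (hk : k ∉ Finset.range (p.1 + 1)) : ‖w p k‖ = 0 :=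
    norm_eq_zero.2 (w_eq_zero p k hk)
  have norm_w (p : ℕ × ℕ) (k : ℕ) : ‖w p k‖ = ZA d k p.1 * ‖kernel (Y k) x y‖ := by
    rw [norm_mul, Complex.norm_real, Real.norm_of_nonneg (ZA_nonneg _ _)]
  have tsum_norm_w_le (p : ℕ × ℕ) : ∑' k, ‖w p k‖ ≤ 1 := by
    rw [tsum_eq_sum (norm_w_eq_zero p)]
    simp only [norm_w]
    exact sum_ZA_mul_norm_kernel_le hY _ hx hy
  have tsum_w (p : ℕ × ℕ) : ∑' k, w p k = (inner ℝ x y : ℝ) ^ p.1 :=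
    (tsum_eq_sum (w_eq_zero p)).trans (inner_pow_eq_sum_kernel hY _ hx hy).symm
  refine (hasSum_tsum_mul_of_tsum_norm_le (summable_norm_expandTerm hs hc)
    (fun p => summable_of_ne_finset_zero (norm_w_eq_zero p)) tsum_norm_w_le
    (by simpa only [tsum_w] using hasSum_expandTerm hs hc abs_inner_le hS)).congr_fun fun k => ?_
  rw [← tsum_mul_left]
  exact tsum_congr fun p => by ring

end Expansion

section Radial

variable {d : ℕ}

lemma T_eq_sum_Icc (j k m : ℕ) :
    T d j k m = ∑ n ∈ Finset.Icc ((j + 1) / 2) j,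
      ZA d k (2 * n - j) * (-2) ^ (2 * n - j) * (n.choose (2 * n - j) : ℝ) / (n ! : ℝ) * B n m := by
  refine Finset.sum_subset (Finset.Icc_subset_Icc_left (by omega)) fun n hn hn' => ?_
  rw [Finset.mem_Icc] at hn hn'
  by_cases h : n < m
  · rw [B_eq_zero_of_lt h, mul_zero]
  · rw [ZA_eq_zero_of_lt (by omega)]
    ring

/-- The pairs `(i, q)` with `i + 2 q = j`, parametrised by `n = i + q`. -/
def weightedAntidiagonal (j : ℕ) : Finset (ℕ × ℕ) :=
  (Finset.Icc ((j + 1) / 2) j).image fun n => (2 * n - j, j - n)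

lemma mem_weightedAntidiagonal {j : ℕ} {p : ℕ × ℕ} :
    p ∈ weightedAntidiagonal j ↔ p.1 + 2 * p.2 = j := by
  obtain ⟨i, q⟩ := p
  simp only [weightedAntidiagonal, Finset.mem_image, Finset.mem_Icc, Prod.mk.injEq]
  constructor
  · rintro ⟨n, hn, rfl, rfl⟩
    omega
  · rintro rfl
    exact ⟨i + q, by omega, by omega, by omega⟩

lemma sum_weightedAntidiagonal {M : Type*} [AddCommMonoid M] (j : ℕ) (f : ℕ × ℕ → M) :
    ∑ p ∈ weightedAntidiagonal j, f p = ∑ n ∈ Finset.Icc ((j + 1) / 2) j, f (2 * n - j, j - n) := by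
  refine Finset.sum_image fun a ha b hb hab => ?_
  simp only [Finset.coe_Icc, Set.mem_Icc, Prod.mk.injEq] at ha hb hab
  omega

variable {K : ℝ → ℂ} {r r' : ℝ}

lemma taylorCoeff_comp_mul_sqrt_eq_sum_Icc (hr : 0 < r) (hK : AnalyticOnNhd ℝ K (Set.Ioi 0))
    {n j : ℕ} (hnj : n ≤ j) :
    taylorCoeff (fun ε => K (r * √(1 + ε))) n =
      (∑ m ∈ Finset.Icc 0 j, (B n m : ℂ) * (r : ℂ) ^ m * iteratedDeriv m K r) / (n ! : ℂ) := by
  rw [taylorCoeff_comp_mul_sqrt hr hK]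
  congr 1
  refine Finset.sum_subset (fun m hm => ?_) fun m _ hm => ?_
  · rw [Finset.mem_range] at hm
    exact Finset.mem_Icc.2 ⟨m.zero_le, by omega⟩
  · rw [Finset.mem_range] at hm
    rw [B_eq_zero_of_lt (by omega), Complex.ofReal_zero, zero_mul, zero_mul]

lemma radialTerm_eq_sum (hr : 0 < r) (hK : AnalyticOnNhd ℝ K (Set.Ioi 0)) (k j : ℕ) :
    radialTerm d K k r' r j =
      ∑ p ∈ weightedAntidiagonal j,
        expandTerm (taylorCoeff fun ε => K (r * √(1 + ε))) (r' / r) p * (ZA d k p.1 : ℂ) := by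
  have r_ne_zero : (r : ℂ) ≠ 0 := Complex.ofReal_ne_zero.2 hr.ne'
  simp only [sum_weightedAntidiagonal, radialTerm, T_eq_sum_Icc, Complex.ofReal_sum,
    Finset.mul_sum]
  rw [Finset.sum_comm]
  refine Finset.sum_congr rfl fun n hn => ?_
  rw [Finset.mem_Icc] at hn
  have powers : (-2 * (r' / r : ℝ) : ℂ) ^ (2 * n - j) * (((r' / r : ℝ) : ℂ) ^ 2) ^ (j - n) =
      (-2) ^ (2 * n - j) * (r' ^ j / r ^ j) := by
    rw [mul_pow, ← pow_mul, mul_assoc, ← pow_add, show 2 * n - j + 2 * (j - n) = j by omega,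
      Complex.ofReal_div, div_pow]
  simp only [expandTerm]
  rw [show 2 * n - j + (j - n) = n by omega, mul_assoc (taylorCoeff _ _ * _), powers,
    taylorCoeff_comp_mul_sqrt_eq_sum_Icc hr hK hn.2, Finset.sum_div]
  simp only [Finset.sum_mul]
  refine Finset.sum_congr rfl fun m _ => ?_
  rw [zpow_sub₀ r_ne_zero, zpow_natCast, zpow_natCast]
  push_cast
  field_simp

lemma radialTerm_eq_zero_of_lt (hr : 0 < r) (hK : AnalyticOnNhd ℝ K (Set.Ioi 0)) {k j : ℕ}
    (h : j < k) : radialTerm d K k r' r j = 0 := by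
  rw [radialTerm_eq_sum hr hK]
  refine Finset.sum_eq_zero fun p hp => ?_
  rw [mem_weightedAntidiagonal] at hp
  rw [ZA_eq_zero_of_lt (by omega), Complex.ofReal_zero, mul_zero]

theorem hasSum_radialTerm (hd : 2 ≤ d) (hr : 0 < r) (hr' : 0 ≤ r')
    (hK : AnalyticOnNhd ℝ K (Set.Ioi 0))
    (hc : Summable fun n => ‖taylorCoeff (fun ε => K (r * √(1 + ε))) n‖ *
      (r' / r * (r' / r + 2)) ^ n) (k : ℕ) :
    HasSum (fun i => radialTerm d K k r' r (k + i))
      (∑' p : ℕ × ℕ,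
        expandTerm (taylorCoeff fun ε => K (r * √(1 + ε))) (r' / r) p * (ZA d k p.1 : ℂ)) := by
  have hasSum_all := hasSum_sum_fiber (g := fun p : ℕ × ℕ => p.1 + 2 * p.2)
    mem_weightedAntidiagonal (summable_expandTerm_mul_ZA hd (div_nonneg hr' hr.le) hc k).hasSum
  simp only [← radialTerm_eq_sum hr hK] at hasSum_all
  have tail := (hasSum_nat_add_iff' k).2 hasSum_all
  rw [Finset.sum_eq_zero fun j hj => radialTerm_eq_zero_of_lt hr hK (Finset.mem_range.1 hj),
    sub_zero] at tail
  simpa only [add_comm k] using tail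

end Radial

section Separation

open InnerProductGeometry

variable {d : ℕ} {r r' : ℝ} {u v : E d}

lemma neg_one_le_eps (r' r γ : ℝ) : -1 ≤ eps r' r γ := by
  rw [eps]
  nlinarith [sq_nonneg (r' / r - Real.cos γ), Real.sin_sq_add_cos_sq γ, sq_nonneg (Real.sin γ)]

lemma eps_angle (hu : ‖u‖ = 1) (hv : ‖v‖ = 1) :
    eps r' r (angle u v) = r' / r * (r' / r - 2 * inner ℝ u v) := by
  rw [eps, inner_eq_cos_angle_of_norm_eq_one hu hv]

lemma norm_smul_sub_smul (hr : 0 < r) (hu : ‖u‖ = 1) (hv : ‖v‖ = 1) :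
    ‖r' • v - r • u‖ = r * √(1 + eps r' r (angle u v)) := by
  have law_of_cosines : ‖r' • v - r • u‖ ^ 2 = r ^ 2 * (1 + eps r' r (angle u v)) := by
    rw [norm_sub_sq_real, norm_smul, norm_smul, hu, hv, real_inner_smul_left,
      real_inner_smul_right, real_inner_comm, eps_angle hu hv, mul_one, mul_one, Real.norm_eq_abs,
      Real.norm_eq_abs, sq_abs, sq_abs]
    field_simp
    ring
  rw [← Real.sqrt_sq (norm_nonneg _), law_of_cosines, Real.sqrt_mul (sq_nonneg r),
    Real.sqrt_sq hr.le]

lemma exists_norm_eq_one_norm_smul_eq [NeZero d] (x : E d) : ∃ u : E d, ‖u‖ = 1 ∧ ‖x‖ • u = x := by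
  by_cases hx : x = 0
  · obtain ⟨u, hu⟩ := exists_norm_eq (E d) zero_le_one
    exact ⟨u, hu, by rw [hx, norm_zero, zero_smul]⟩
  · exact ⟨‖x‖⁻¹ • x, norm_smul_inv_norm hx, smul_inv_smul₀ (norm_ne_zero_iff.2 hx) x⟩

lemma angularPart_smul (p : MvPolynomial (Fin d) ℂ) (hr : 0 < r) (x : E d) :
    angularPart d p (r • x) = angularPart d p x := by
  have direction : ‖r • x‖⁻¹ • r • x = ‖x‖⁻¹ • x := by
    rw [norm_smul, Real.norm_of_nonneg hr.le, smul_smul, mul_inv_rev, inv_mul_cancel_right₀ hr.ne']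
  change MvPolynomial.eval (fun i => (((‖r • x‖⁻¹ • r • x) i : ℝ) : ℂ)) p = _
  rw [direction]
  rfl

lemma IsHarmonicBasis.apply_smul {k : ℕ} {κ : Type*} {Y : κ → E d → ℂ} (hY : IsHarmonicBasis d k Y)
    (hr : 0 < r) (h : κ) (x : E d) : Y h (r • x) = Y h x := by
  obtain ⟨p, -, hp⟩ := hY.exists_angularPart_eq h
  rw [← hp, angularPart_smul p hr]

lemma IsHarmonicBasis.apply_eq_apply {κ : Type*} {Y : κ → E d → ℂ} (hY : IsHarmonicBasis d 0 Y)
    (h : κ) (x y : E d) : Y h x = Y h y := by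
  obtain ⟨p, hp, hpY⟩ := hY.exists_angularPart_eq h
  rw [← hpY, eq_C_of_isHomogeneous_zero hp.1]
  simp [angularPart]

variable {K : ℝ → ℂ}

lemma radialFactor_zero_left {k : ℕ} (hk : k ≠ 0) (r : ℝ) : radialFactor d K k 0 r = 0 := by
  simp [radialFactor, radialTerm, hk]

lemma kernel_smul_smul_mul_radialFactor {k : ℕ} {κ : Type*} [Fintype κ] {Y : κ → E d → ℂ}
    (hY : IsHarmonicBasis d k Y) (hr : 0 < r) (hr' : 0 ≤ r') :
    kernel Y (r • u) (r' • v) * radialFactor d K k r' r =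
      kernel Y u v * radialFactor d K k r' r := by
  rcases hr'.eq_or_lt with rfl | hr'
  · rcases eq_or_ne k 0 with rfl | hk
    · simp only [kernel, hY.apply_smul hr, hY.apply_eq_apply _ ((0 : ℝ) • v) v]
    · rw [radialFactor_zero_left hk, mul_zero, mul_zero]
  · simp only [kernel, hY.apply_smul hr, hY.apply_smul hr']

lemma summable_norm_taylorCoeff_of_eps_lt (hr : 0 < r) (hr' : 0 ≤ r')
    (hconv : ∀ γ : ℝ, ENNReal.ofReal |eps r' r γ| < taylorRadius K r) :
    Summable fun n => ‖taylorCoeff (fun ε => K (r * √(1 + ε))) n‖ *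
      (r' / r * (r' / r + 2)) ^ n := by
  have eps_pi : eps r' r Real.pi = r' / r * (r' / r + 2) := by
    rw [eps, Real.cos_pi]
    ring
  refine summable_norm_taylorCoeff_mul_pow (by positivity) ?_
  rw [← taylorRadius_eq, ← eps_pi]
  exact (ENNReal.ofReal_le_ofReal (le_abs_self _)).trans_lt (hconv _)

theorem hasSum_kernel_mul_radialFactor (hd : 2 ≤ d) {ι : ℕ → Type*} [∀ k, Fintype (ι k)]
    {Y : (k : ℕ) → ι k → E d → ℂ} (hY : ∀ k, IsHarmonicBasis d k (Y k)) (hu : ‖u‖ = 1)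
    (hv : ‖v‖ = 1) (hr : 0 < r) (hr' : 0 ≤ r') (hK : AnalyticOnNhd ℝ K (Set.Ioi 0))
    (hconv : ∀ γ : ℝ, ENNReal.ofReal |eps r' r γ| < taylorRadius K r)
    (h0 : r' • v = r • u → ContinuousWithinAt K (Set.Ioi 0) 0) :
    HasSum (fun k => kernel (Y k) u v * radialFactor d K k r' r) (K ‖r' • v - r • u‖) := by
  have : NeZero d := ⟨by omega⟩
  have summable_taylorCoeff := summable_norm_taylorCoeff_of_eps_lt hr hr' hconv
  have continuous_at_zero (h : eps r' r (angle u v) = -1) :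
      ContinuousWithinAt K (Set.Ioi 0) 0 := by
    refine h0 (sub_eq_zero.1 (norm_eq_zero.1 ?_))
    rw [norm_smul_sub_smul hr hu hv, h, add_neg_cancel, Real.sqrt_zero, mul_zero]
  have taylor := hasSum_taylorCoeff_comp_mul_sqrt hr hK (neg_one_le_eps r' r (angle u v))
    continuous_at_zero (hconv _)
  rw [← norm_smul_sub_smul hr hu hv, eps_angle hu hv] at taylor
  refine (hasSum_kernel_mul hY hu hv (div_nonneg hr' hr.le) summable_taylorCoeff taylor).congr_fun
    fun k => ?_
  rw [radialFactor, (hasSum_radialTerm hd hr hr' hK summable_taylorCoeff k).tsum_eq]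

end Separation

end FKT

end

theorem theorem1 (d : ℕ) (hd : 2 ≤ d)
    (ι : ℕ → Type*) [∀ k, Fintype (ι k)]
    (Y : (k : ℕ) → ι k → FKT.E d → ℂ) (hY : ∀ k, FKT.IsHarmonicBasis d k (Y k))
    (K : ℝ → ℂ) (hK : AnalyticOnNhd ℝ K (Set.Ioi 0))
    (x x' : FKT.E d) (hx : x ≠ 0)
    (hconv : ∀ γ : ℝ, ENNReal.ofReal |FKT.eps ‖x'‖ ‖x‖ γ| < FKT.taylorRadius K ‖x‖)
    (h0 : x' = x → ContinuousWithinAt K (Set.Ioi 0) 0) :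
    (∀ k : ℕ, Summable fun i : ℕ => FKT.radialTerm d K k ‖x'‖ ‖x‖ (k + i)) ∧
    HasSum
      (fun k : ℕ => ∑ h : ι k,
        Y k h x * starRingEnd ℂ (Y k h x') * FKT.radialFactor d K k ‖x'‖ ‖x‖)
      (K ‖x' - x‖) := by
  have : NeZero d := ⟨by omega⟩
  have hr : 0 < ‖x‖ := norm_pos_iff.2 hx
  have hr' : 0 ≤ ‖x'‖ := norm_nonneg x'
  obtain ⟨u, hu, hux⟩ := FKT.exists_norm_eq_one_norm_smul_eq x
  obtain ⟨v, hv, hvx'⟩ := FKT.exists_norm_eq_one_norm_smul_eq x'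
  have summable_taylorCoeff := FKT.summable_norm_taylorCoeff_of_eps_lt hr hr' hconv
  refine ⟨fun k => (FKT.hasSum_radialTerm hd hr hr' hK summable_taylorCoeff k).summable, ?_⟩
  have expansion := FKT.hasSum_kernel_mul_radialFactor hd hY hu hv hr hr' hK hconv
    (by rwa [hux, hvx'])
  rw [hux, hvx'] at expansion
  refine expansion.congr_fun fun k => ?_
  have direction_only :=
    FKT.kernel_smul_smul_mul_radialFactor (u := u) (v := v) (K := K) (hY k) hr hr'
  rw [← direction_only, hux, hvx', FKT.kernel, Finset.sum_mul]
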